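/- **Setting.** Let $\Pi$ be a finite non-empty set of decisions, $O$ a measurable space with a $\sigma$-finite base measure $\nu$, and $R:O\to\mathbb R$ a measurable reward function. An instance $f$ assigns to each $\pi\in\Pi$ a bounded probability density $f[\pi]$ with respect to $\nu$ (we also write $f[\pi]$ for the distribution). Let $\mathcal F$ be a finite set of instances such that $0\le R(o)\le R_{\max}$ for $f[\pi]$-almost every $o$, for all $f\in\mathcal F$, $\pi\in\Pi$. Put $R_f(\pi)=\mathbb E_{o\sim f[\pi]}[R(o)]$ and assume that each $f\in\mathcal F$ has a unique optimal decision $\pi^\star(f)=\arg\max_\pi R_f(\pi)$; let $\Delta(f,\pi)=R_f(\pi^\star(f))-R_f(\pi)$. In round $t$ the learner chooses $\pi_t$ from the history and observes $o_t\sim f^\star[\pi_t]$, where $f^\star\in\mathcal F$ is unknown, and $$\mathrm{Reg}_{f^\star,n}=\mathbb E_{f^\star}\Big[\sum_{t=1}^n\big(\max_{\pi}R_{f^\star}(\pi)-R_{f^\star}(\pi_t)\big)\Big].$$ **Complexity.** For $f\in\mathcal F$ and $N\in\mathbb R$ let $\mathcal C(f,N)$ be the infimum of $\sum_\pi w_\pi\Delta(f,\pi)$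 over $w\in\mathbb R_{\ge0}^{\Pi}$ with $w_\pi\le N$ for all $\pi$ and $\sum_\pi w_\pi D_{\mathrm{KL}}(f[\pi]\|g[\pi])\ge1$ for all $g\in\mathcal F$ with $\pi^\star(g)\ne\pi^\star(f)$ (with $0\cdot\infty=0$ and $\inf\emptyset=\infty$), and let $\mathcal C(f)=\lim_{N\to\infty}\mathcal C(f,N)$. **Condition 1.** For $\zeta\in(0,1)$ let $D_\zeta(p\|q)=\frac1{\zeta-1}\ln\int p^\zeta q^{1-\zeta}\,d\nu\in[0,\infty]$. There are constants $c_1,c_2,c_3>0$, numbers $\iota(f)>0$ $(f\in\mathcal F)$ and numbers $\lambda_0(\alpha,\epsilon,f)\ge\epsilon^{c_1}\min\{1/\alpha,c_2\}^{c_3}\iota(f)$ such that for all $\alpha>0$, $\epsilon\in(0,1)$, $f,g\in\mathcal F$, $\pi\in\Pi$ and all $\lambda\in(0,1)$ with $\lambda\le\lambda_0(\alpha,\epsilon,f)$, $$D_{1-\lambda}(f[\pi]\|g[\pi])\ge\min\{D_{\mathrm{KL}}(f[\pi]\|g[\pi])-\epsilon,\ \alpha\}.$$ **Algorithm Test-to-Commit**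 (horizon $n$, $N_n=(\ln\ln n)^{1/4}$). 1. *Initialization.* Play each decision $\lceil\ln n/\ln\ln n\rceil$ times, in any order; let $\hat f\in\mathcal F$ maximize the log-likelihood $\sum_i\ln f[\hat\pi_i](\hat o_i)$ of these rounds over $f\in\mathcal F$ ($\ln0=-\infty$), with arbitrary tie-breaking. 2. *Identification.* Let $\hat w$ be a solution of the program defining $\mathcal C(\hat f,N_n)$; more generally, any feasible point whose value is at most $\mathcal C(\hat f,N_n)+\eta_n$, where $\eta_n\ge0$ is a fixed sequence with $\eta_n\to0$ (this matters when the infimum is not attained, which can happen if some KL divergence is infinite). If the program is infeasible, $\hat w$ is arbitrary. Put $\bar w_\pi=(1+1/N_n)\hat w_\pi+1/N_n$ and play each $\pi$ exactly $\lceil\bar w_\pi\ln n\rceil$ times, in any order depending only on $\hat f$; let $(\pi_i,o_i)_{i\le m}$ be these rounds. Accept $\hat f$ if $\sum_{i=1}^m\ln\frac{\hat f[\pi_i](o_i)}{g[\pi_i](o_i)}\ge\ln n$ for all $g\in\mathcal F$ with $\pi^\star(g)\ne\pi^\star(\hat f)$ (with $x/0=\infty$ for $x>0$, $0/0=0$,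 and a sum with a term $-\infty$ equal to $-\infty$). 3. *Exploitation.* If $\hat f$ is accepted, play $\pi^\star(\hat f)$ in all remaining rounds. Otherwise run UCB afresh in the remaining rounds: always play a decision with the largest index, arbitrary tie-breaking, where the index is $\infty$ for a decision not yet played in this step and otherwise its average reward in this step plus $R_{\max}\sqrt{2\ln(n^2)/T}$, with $T$ the number of its plays in this step. Only the first $n$ rounds count; for the finitely many small $n$ for which the formulas above are undefined, the algorithm is arbitrary. **Theorem.** If $\mathcal F$ is finite and satisfies Condition 1, then for every $f^\star\in\mathcal F$ the limit $\mathcal C(f^\star)$ exists and is finite, and Test-to-Commit satisfies $$\limsup_{n\to\infty}\frac{\mathrm{Reg}_{f^\star,n}}{\ln n}\le\mathcal C(f^\star).$$ -/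

import Mathlib

open MeasureTheory ProbabilityTheory Filter Topology
open scoped ENNReal NNReal

noncomputable section

namespace DecisionMaking

variable {D O : Type*} [MeasurableSpace O]

/-- An instance `f` of an interactive decision making problem with decisions `D` and observations
`O`: for every decision `π`, a bounded probability density `f[π]` with respect to the base measure
`ν`. -/
structure Instance (D : Type*) {O : Type*} [MeasurableSpace O] (ν : Measure O) where
  /-- `density π o` is `f[π](o)`. -/
  density : D → O → ℝ≥0∞
  measurable_density : ∀ π, Measurable (density π)
  lintegral_density : ∀ π, ∫⁻ o, density π o ∂ν = 1
  bounded_density : ∀ π, ⨆ o, density π o < ∞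

variable {ν : Measure O}

/-- The distribution `f[π]` of the observation when decision `π` is played under `f`. -/
def Instance.law (f : Instance D ν) (π : D) : Measure O := ν.withDensity (f.density π)

/-- Expected reward `R_f(π) = E_{o ∼ f[π]} [R(o)]`. -/
def meanReward (R : O → ℝ) (f : Instance D ν) (π : D) : ℝ := ∫ o, R o ∂(f.law π)

/-- `π` maximizes the expected reward under `f`. -/
def IsOptimal (R : O → ℝ) (f : Instance D ν) (π : D) : Prop :=
  ∀ π', meanReward R f π' ≤ meanReward R f π

/-- The optimal decision `π⋆(f)`. -/
def optDecision [Finite D] [Nonempty D] (R : O → ℝ) (f : Instance D ν) : D :=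
  (Finite.exists_max (meanReward R f)).choose

/-- The sub-optimality gap `Δ(f, π) = R_f(π⋆(f)) - R_f(π)`. -/
def gap [Finite D] [Nonempty D] (R : O → ℝ) (f : Instance D ν) (π : D) : ℝ :=
  meanReward R f (optDecision R f) - meanReward R f π

/-! ### Divergences and the uniform convergence condition -/

/-- The Kullback-Leibler divergence `D_KL(f[π] ‖ g[π])`. -/
def kl (f g : Instance D ν) (π : D) : ℝ≥0∞ := InformationTheory.klDiv (f.law π) (g.law π)

/-- The Rényi divergence `D_ζ(f[π] ‖ g[π]) = (ζ - 1)⁻¹ ln ∫ f[π]^ζ g[π]^(1 - ζ) dν` for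
`0 < ζ < 1`; it is `⊤` if the integral vanishes. -/
def renyi (ζ : ℝ) (f g : Instance D ν) (π : D) : EReal :=
  (((ζ - 1)⁻¹ : ℝ) : EReal) *
    ENNReal.log (∫⁻ o, f.density π o ^ ζ * g.density π o ^ (1 - ζ) ∂ν)

/-- Uniform convergence of the Rényi divergences `D_{1-λ}` to the KL divergence on the class `F`. -/
def UniformRenyiConvergence (F : Finset (Instance D ν)) : Prop :=
  ∃ (c₁ c₂ c₃ : ℝ) (ι : Instance D ν → ℝ) (lam₀ : ℝ → ℝ → Instance D ν → ℝ),
    0 < c₁ ∧ 0 < c₂ ∧ 0 < c₃ ∧ (∀ f ∈ F, 0 < ι f) ∧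
    ∀ α : ℝ, 0 < α → ∀ ε : ℝ, 0 < ε → ε < 1 → ∀ f ∈ F,
      ε ^ c₁ * min (1 / α) c₂ ^ c₃ * ι f ≤ lam₀ α ε f ∧
      ∀ lam : ℝ, 0 < lam → lam < 1 → lam ≤ lam₀ α ε f → ∀ g ∈ F, ∀ π : D,
        min ((kl f g π : EReal) - (ε : EReal)) (α : EReal) ≤ renyi (1 - lam) f g π

/-! ### The complexity measure -/

section Complexity

variable [Fintype D] [Nonempty D]

/-- The objective `∑_π w_π Δ(f, π)`. -/
def cost (R : O → ℝ) (f : Instance D ν) (w : D → ℝ≥0) : ℝ := ∑ π, (w π : ℝ) * gap R f π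

/-- The constraints of the program defining `C(f, N)`. -/
def IsFeasible (R : O → ℝ) (F : Finset (Instance D ν)) (f : Instance D ν) (N : ℝ)
    (w : D → ℝ≥0) : Prop :=
  (∀ g ∈ F, optDecision R g ≠ optDecision R f → 1 ≤ ∑ π, (w π : ℝ≥0∞) * kl f g π) ∧
    ∀ π, (w π : ℝ) ≤ N

/-- The value `C(f, N)` of the program (`⊤` if it is infeasible). -/
def complexityAt (R : O → ℝ) (F : Finset (Instance D ν)) (f : Instance D ν) (N : ℝ) : EReal :=
  ⨅ (w : D → ℝ≥0) (_ : IsFeasible R F f N w), (cost R f w : EReal)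

/-- The asymptotic complexity `C(f) = lim_{N → ∞} C(f, N)`. -/
def complexity (R : O → ℝ) (F : Finset (Instance D ν)) (f : Instance D ν) : EReal :=
  limUnder atTop (fun N : ℝ => complexityAt R F f N)

/-- `w` is a solution, up to an additive error `η` in the value, of the program defining
`C(f, N)`. For `η = 0` this says that `w` is a minimizer. -/
def IsSolution (R : O → ℝ) (F : Finset (Instance D ν)) (f : Instance D ν) (N : ℝ) (η : ℝ≥0)
    (w : D → ℝ≥0) : Prop :=
  IsFeasible R F f N w ∧ ∀ w', IsFeasible R F f N w' → cost R f w ≤ cost R f w' + η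

end Complexity

/-! ### Interaction and regret -/

/-- A history of `t` rounds: the decision and the observation of each round. -/
abbrev History (D O : Type*) (t : ℕ) : Type _ := Fin t → D × O

/-- A (measurable) rule that selects the next decision from the history. -/
structure Policy (D O : Type*) [MeasurableSpace D] [MeasurableSpace O] where
  act : (t : ℕ) → History D O t → D
  measurable_act : ∀ t, Measurable (act t)

/-- The law of the first `t` rounds when policy `A` is run on instance `f`: given the history `h`,
the next decision is `A(h)` and the next observation is drawn from `f[A(h)]`. -/
def historyLaw [MeasurableSpace D] (f : Instance D ν) (A : Policy D O) :
    (t : ℕ) → Measure (History D O t)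
  | 0 => Measure.dirac Fin.elim0
  | t + 1 => (historyLaw f A t).bind fun h =>
      (f.law (A.act t h)).map fun o => Fin.snoc (α := fun _ => D × O) h (A.act t h, o)

/-- The expected regret of `A` on `f` over `n` rounds. -/
def regret [MeasurableSpace D] (R : O → ℝ) (f : Instance D ν) (A : Policy D O) (n : ℕ) : ℝ :=
  ∫ h, ∑ i : Fin n, ((⨆ π, meanReward R f π) - meanReward R f (h i).1) ∂(historyLaw f A n)

/-! ### The Test-to-Commit algorithm -/

/-- The log-likelihood `∑_i ln f[π_i](o_i)` of a history, with `ln 0 = -∞`. -/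
def logLikelihood (f : Instance D ν) {t : ℕ} (h : History D O t) : EReal :=
  ∑ i, ENNReal.log (f.density (h i).1 (h i).2)

/-- The log-likelihood ratio `∑_i ln (f[π_i](o_i) / g[π_i](o_i))` over the rounds `a ≤ i < b`
(rounds are numbered from `0`). Here `x / 0 = ∞` for `x > 0`, `0 / 0 = 0`, and a sum with a term
`-∞` is `-∞`. -/
def logLikelihoodRatio (f g : Instance D ν) {t : ℕ} (h : History D O t) (a b : ℕ) : EReal :=
  ∑ i ∈ Finset.univ.filter (fun i : Fin t => a ≤ (i : ℕ) ∧ (i : ℕ) < b),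
    ENNReal.log (f.density (h i).1 (h i).2 / g.density (h i).1 (h i).2)

/-- The test of `f` on the rounds `a ≤ i < b`: all log-likelihood ratios against instances with a
different optimal decision are at least `ln n`. -/
def Accepts [Finite D] [Nonempty D] (R : O → ℝ) (F : Finset (Instance D ν)) (n : ℕ)
    (f : Instance D ν) {t : ℕ} (h : History D O t) (a b : ℕ) : Prop :=
  ∀ g ∈ F, optDecision R g ≠ optDecision R f →
    ((Real.log n : ℝ) : EReal) ≤ logLikelihoodRatio f g h a b

section UCB

variable [DecidableEq D]

/-- The number of times that `π` is played in the rounds `i ≥ s` of `h`. -/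
def playCount {t : ℕ} (h : History D O t) (s : ℕ) (π : D) : ℕ :=
  (Finset.univ.filter fun i : Fin t => s ≤ (i : ℕ) ∧ (h i).1 = π).card

/-- The average reward of `π` in the rounds `i ≥ s` of `h`. -/
def empiricalMean (R : O → ℝ) {t : ℕ} (h : History D O t) (s : ℕ) (π : D) : ℝ :=
  (∑ i ∈ Finset.univ.filter (fun i : Fin t => s ≤ (i : ℕ) ∧ (h i).1 = π), R (h i).2) /
    playCount h s π

/-- The index of the algorithm UCB(δ) with `δ = 1 / n ^ 2`, started in round `s`, for rewards in
`[0, Rmax]`: it is `∞` for a decision that was not played yet, and otherwise the average reward plus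
`Rmax * √(2 ln (1 / δ) / T)`, where `T` is the number of plays. -/
def ucbIndex (R : O → ℝ) (Rmax : ℝ) (n : ℕ) {t : ℕ} (h : History D O t) (s : ℕ) (π : D) : EReal :=
  if playCount h s π = 0 then ⊤
  else ((empiricalMean R h s π +
    Rmax * Real.sqrt (2 * Real.log ((n : ℝ) ^ 2) / playCount h s π) : ℝ) : EReal)

end UCB

/-- The bound `(ln ln n)^{1/4}` in the program that the algorithm solves. -/
def programBound (n : ℕ) : ℝ := Real.log (Real.log n) ^ (1 / 4 : ℝ)

/-- A run of Test-to-Commit with horizon `n`: the steps of the algorithm together with the choices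
that it leaves open (the order of the plays within a step, the solution of the program, and the
tie-breaking in the maximum likelihood estimation and in UCB). -/
structure TestToCommit [Fintype D] [DecidableEq D] [Nonempty D] [MeasurableSpace D]
    (R : O → ℝ) (Rmax : ℝ) (F : Finset (Instance D ν)) (n : ℕ) (η : ℝ≥0)
    extends Policy D O where
  /-- The decisions of the initialization step. -/
  initList : List D
  count_initList : ∀ π, initList.count π = ⌈Real.log n / Real.log (Real.log n)⌉₊
  /-- The maximum likelihood estimate. -/
  mle : History D O initList.length → F
  measurable_mle : ∀ f, MeasurableSet (mle ⁻¹' {f})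
  isMax_mle : ∀ h, ∀ f ∈ F, logLikelihood f h ≤ logLikelihood (mle h : Instance D ν) h
  /-- The solution of the program defining `C(f, (ln ln n)^{1/4})`. -/
  weight : F → D → ℝ≥0
  isSolution_weight : ∀ f : F, (∃ w, IsFeasible R F f (programBound n) w) →
    IsSolution R F f (programBound n) η (weight f)
  /-- The decisions of the identification step, given the estimate. -/
  identList : F → List D
  count_identList : ∀ f π, (identList f).count π =
    ⌈((1 + 1 / programBound n) * weight f π + 1 / programBound n) * Real.log n⌉₊
  act_init : ∀ t (ht : t < initList.length) h, act t h = initList[t]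
  act_ident : ∀ t (ht : initList.length ≤ t) h f, mle (fun i => h (Fin.castLE ht i)) = f →
    ∀ hlt : t - initList.length < (identList f).length,
      act t h = (identList f)[t - initList.length]
  act_commit : ∀ t (ht : initList.length ≤ t) h f, mle (fun i => h (Fin.castLE ht i)) = f →
    initList.length + (identList f).length ≤ t →
    Accepts R F n f h initList.length (initList.length + (identList f).length) →
      act t h = optDecision R (f : Instance D ν)
  act_ucb : ∀ t (ht : initList.length ≤ t) h f, mle (fun i => h (Fin.castLE ht i)) = f →
    initList.length + (identList f).length ≤ t →
    ¬ Accepts R F n f h initList.length (initList.length + (identList f).length) →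
      ∀ π, ucbIndex R Rmax n h (initList.length + (identList f).length) π ≤
        ucbIndex R Rmax n h (initList.length + (identList f).length) (act t h)

end DecisionMaking

end

/-!
Write `N = (ln ln n) ^ (1/4)`. Each way in which the algorithm can err has a probability that is
bounded by a moment of a likelihood ratio: under `f`, the product of the factors
`(g[π](o) / f[π](o)) ^ s` over the rounds is controlled by its conditional moments round by round,
each of them at most `1` for `0 ≤ s ≤ 1`.

* With `s = 1/2` every play of a decision that separates `f⋆` from `g` contributes a factor bounded
  away from `1`, so the maximum likelihood estimate has the wrong laws with probability of order
  at most `exp (-c ln n / ln ln n)`. This beats the length `O(N ln n)` of the identification step.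
* With `s = 1`, a wrong instance is accepted with probability `O(1 / n)`, so a wrong commitment
  costs `O(1)` in expectation.
* With `s = λ` of order `N ^ (-q)` the moment is controlled by the Rényi divergence of order
  `1 - λ`, which Condition 1 compares with the KL divergence truncated at level `2N`. The weights
  `(1 + 1/N) ŵ + 1/N` make the truncated KL sum exceed `(1 + 1/(2N)) ln n`, so the true instance is
  rejected with probability of order at most `exp (-A N ^ (-q) ln n / (2N))`, which tends to `0`.

After a rejection UCB pays only `O(ln n)`, hence `o(ln n)` in expectation. What is left is the
cost of identification under `f⋆`, which is `(1 + o(1)) C(f⋆, N) ln n`.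
-/

namespace DecisionMaking

noncomputable section

section Probability

variable {Ω : Type*} [MeasurableSpace Ω] {μ : Measure Ω}

theorem measureReal_le_of_ae_imp [IsFiniteMeasure μ] {s t : Set Ω}
    (h : ∀ᵐ ω ∂μ, ω ∈ s → ω ∈ t) : μ.real s ≤ μ.real t :=
  ENNReal.toReal_mono (measure_ne_top μ t) (measure_mono_ae h)

theorem measureReal_exists_le_card_mul {ι : Type*} (s : Finset ι) {p : ι → Ω → Prop} {b : ℝ}
    (h : ∀ i ∈ s, μ.real {ω | p i ω} ≤ b) : μ.real {ω | ∃ i ∈ s, p i ω} ≤ s.card * b := by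
  have eq_iUnion : {ω | ∃ i ∈ s, p i ω} = ⋃ i ∈ s, {ω | p i ω} := by
    ext ω
    simp
  rw [eq_iUnion, ← nsmul_eq_mul]
  exact (measureReal_biUnion_finset_le s _).trans (Finset.sum_le_card_nsmul s _ b h)

theorem integral_le_add_sum_mul_measureReal [IsProbabilityMeasure μ] {ι : Type*} {s : Finset ι}
    {g : Ω → ℝ} {c₀ : ℝ} {c : ι → ℝ} {E : ι → Set Ω} (hg : Integrable g μ)
    (hc : ∀ i ∈ s, 0 ≤ c i)
    (h : ∀ᵐ ω ∂μ, g ω ≤ c₀ + ∑ i ∈ s, (E i).indicator (fun _ => c i) ω) :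
    ∫ ω, g ω ∂μ ≤ c₀ + ∑ i ∈ s, c i * μ.real (E i) := by
  have indicator_integrable (i : ι) :
      Integrable ((toMeasurable μ (E i)).indicator fun _ => c i) μ :=
    (integrable_const _).indicator (measurableSet_toMeasurable _ _)
  calc
    ∫ ω, g ω ∂μ ≤ ∫ ω, (c₀ + ∑ i ∈ s, (toMeasurable μ (E i)).indicator (fun _ => c i) ω) ∂μ := by
      refine integral_mono_ae hg ((integrable_const _).add
        (integrable_finsetSum s fun i _ => indicator_integrable i)) ?_
      filter_upwards [h] with ω hω
      refine hω.trans (add_le_add_right (Finset.sum_le_sum fun i hi => ?_) _)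
      exact Set.indicator_le_indicator_of_subset (subset_toMeasurable μ (E i)) (fun _ => hc i hi) ω
    _ = c₀ + ∑ i ∈ s, c i * μ.real (E i) := by
      rw [integral_add (integrable_const _)
          (integrable_finsetSum s fun i _ => indicator_integrable i),
        integral_finsetSum s fun i _ => indicator_integrable i]
      simp [integral_indicator_const, measureReal_def, measure_toMeasurable, mul_comm]

end Probability

section Instances

variable {D O : Type*} [MeasurableSpace O] {ν : Measure O}

instance Instance.isProbabilityMeasure_law (f : Instance D ν) (π : D) :
    IsProbabilityMeasure (f.law π) :=
  ⟨by rw [Instance.law, withDensity_apply _ MeasurableSet.univ, Measure.restrict_univ,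
    f.lintegral_density]⟩

theorem Instance.nonempty_prod [Nonempty D] (f : Instance D ν) : Nonempty (D × O) :=
  have := nonempty_of_isProbabilityMeasure (f.law (Classical.arbitrary D))
  inferInstance

theorem Instance.density_ne_top (f : Instance D ν) (π : D) (o : O) : f.density π o ≠ ∞ :=
  ((le_iSup (f.density π) o).trans_lt (f.bounded_density π)).ne

theorem Instance.ae_density_ne_zero (f : Instance D ν) (π : D) :
    ∀ᵐ o ∂(f.law π), f.density π o ≠ 0 := by
  rw [Instance.law, ae_withDensity_iff (f.measurable_density π)]
  exact ae_of_all _ fun _ ho => ho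

theorem meanReward_congr (R : O → ℝ) {f g : Instance D ν} (h : f.law = g.law) :
    meanReward R f = meanReward R g := by
  funext π
  rw [meanReward, meanReward, h]

theorem kl_congr {f f' : Instance D ν} (h : f.law = f'.law) (g : Instance D ν) :
    kl f g = kl f' g := by
  funext π
  rw [kl, kl, h]

theorem exists_kl_ne_zero {f g : Instance D ν} (h : f.law ≠ g.law) : ∃ π, kl f g π ≠ 0 := by
  by_contra! hc
  exact h (funext fun π => InformationTheory.klDiv_eq_zero_iff.1 (hc π))

variable [Finite D] [Nonempty D]

theorem optDecision_congr (R : O → ℝ) {f g : Instance D ν} (h : f.law = g.law) :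
    optDecision R f = optDecision R g := by
  simp only [optDecision, meanReward_congr R h]

theorem gap_congr (R : O → ℝ) {f g : Instance D ν} (h : f.law = g.law) :
    gap R f = gap R g := by
  funext π
  rw [gap, gap, optDecision_congr R h, meanReward_congr R h]

theorem meanReward_le_optDecision (R : O → ℝ) (f : Instance D ν) (π : D) :
    meanReward R f π ≤ meanReward R f (optDecision R f) :=
  (Finite.exists_max (meanReward R f)).choose_spec π

theorem gap_nonneg (R : O → ℝ) (f : Instance D ν) (π : D) : 0 ≤ gap R f π :=
  sub_nonneg.2 (meanReward_le_optDecision R f π)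

theorem gap_optDecision (R : O → ℝ) (f : Instance D ν) : gap R f (optDecision R f) = 0 :=
  sub_self _

theorem iSup_meanReward (R : O → ℝ) (f : Instance D ν) :
    ⨆ π, meanReward R f π = meanReward R f (optDecision R f) :=
  le_antisymm (ciSup_le (meanReward_le_optDecision R f))
    (le_ciSup (Set.finite_range (meanReward R f)).bddAbove _)

theorem gap_le {R : O → ℝ} {Rmax : ℝ} (hR : Measurable R) {f : Instance D ν}
    (hbdd : ∀ π, ∀ᵐ o ∂(f.law π), 0 ≤ R o ∧ R o ≤ Rmax) (π : D) : gap R f π ≤ Rmax := by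
  have integrable_reward (π : D) : Integrable R (f.law π) :=
    Integrable.of_mem_Icc 0 Rmax hR.aemeasurable (hbdd π)
  have mean_opt_le : meanReward R f (optDecision R f) ≤ Rmax := by
    simpa [meanReward] using integral_mono_ae (integrable_reward (optDecision R f))
      (integrable_const Rmax) ((hbdd _).mono fun _ ho => ho.2)
  have mean_nonneg : 0 ≤ meanReward R f π :=
    integral_nonneg_of_ae ((hbdd π).mono fun _ ho => ho.1)
  rw [gap]
  linarith

theorem nonneg_of_gap_le {R : O → ℝ} {Rmax : ℝ} {f : Instance D ν}
    (hle : ∀ π, gap R f π ≤ Rmax) : 0 ≤ Rmax :=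
  (gap_nonneg R f (Classical.arbitrary D)).trans (hle _)

theorem sum_gap_le_card_mul {R : O → ℝ} {Rmax : ℝ} {f : Instance D ν}
    (hle : ∀ π, gap R f π ≤ Rmax) {ι : Type*} (s : Finset ι) (π : ι → D) :
    ∑ i ∈ s, gap R f (π i) ≤ s.card * Rmax := by
  rw [← nsmul_eq_mul]
  exact Finset.sum_le_card_nsmul s _ Rmax fun i _ => hle (π i)

end Instances

/-! ### Moments of the likelihood ratio -/

section RatioMoment

variable {D O : Type*} [MeasurableSpace O] {ν : Measure O}

/-- The moment of order `lam` of the likelihood ratio `g[π] / f[π]` under `f[π]`. For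
`0 < lam < 1` it is at most `exp (-lam * D_{1-lam}(f[π] ‖ g[π]))`, so it is the quantity that
controls the supermartingales built from likelihood ratios. -/
def ratioMoment (lam : ℝ) (f g : Instance D ν) (π : D) : ℝ≥0∞ :=
  ∫⁻ o, (g.density π o / f.density π o) ^ lam ∂(f.law π)

/-- The truncation `max 0 (min (D_KL(f[π] ‖ g[π]) - ε) α)` of the KL divergence, for
`0 ≤ ε, α`; the subtraction of extended nonnegative reals takes care of the maximum. -/
def truncKL (f g : Instance D ν) (ε α : ℝ) (π : D) : ℝ :=
  (min (kl f g π - ENNReal.ofReal ε) (ENNReal.ofReal α)).toReal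

theorem truncKL_nonneg (f g : Instance D ν) (ε α : ℝ) (π : D) : 0 ≤ truncKL f g ε α π :=
  ENNReal.toReal_nonneg

theorem truncKL_of_eq_top {f g : Instance D ν} {π : D} (h : kl f g π = ∞) (ε : ℝ) {α : ℝ}
    (hα : 0 ≤ α) : truncKL f g ε α π = α := by
  rw [truncKL, h, ENNReal.top_sub ENNReal.ofReal_ne_top, min_eq_right le_top,
    ENNReal.toReal_ofReal hα]

theorem truncKL_of_ne_top {f g : Instance D ν} {π : D} (h : kl f g π ≠ ∞) {ε : ℝ}
    (hε : 0 ≤ ε) (α : ℝ) :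
    truncKL f g ε α π = max (min ((kl f g π).toReal - ε) α) 0 := by
  rw [truncKL, ← ENNReal.ofReal_toReal h, ← ENNReal.ofReal_sub _ hε,
    ← ENNReal.ofReal_mono.map_min, ENNReal.toReal_ofReal', ENNReal.ofReal_toReal h]

theorem ratioMoment_le_lintegral (f g : Instance D ν) (π : D) {lam : ℝ} (hlam : 0 ≤ lam) :
    ratioMoment lam f g π ≤ ∫⁻ o, f.density π o ^ (1 - lam) * g.density π o ^ lam ∂ν := by
  have ratio_meas : Measurable fun o => (g.density π o / f.density π o) ^ lam :=
    ((g.measurable_density π).div (f.measurable_density π)).pow_const _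
  rw [ratioMoment, Instance.law,
    lintegral_withDensity_eq_lintegral_mul _ (f.measurable_density π) ratio_meas]
  refine lintegral_mono fun o => ?_
  rw [Pi.mul_apply]
  rcases eq_or_ne (f.density π o) 0 with hf | hf
  · simp [hf]
  rw [ENNReal.div_rpow_of_nonneg _ _ hlam, div_eq_mul_inv, ← ENNReal.rpow_neg, mul_left_comm,
    mul_comm]
  gcongr
  rw [sub_eq_add_neg, ENNReal.rpow_add _ _ hf (f.density_ne_top π o), ENNReal.rpow_one]

theorem ratioMoment_le_one (f g : Instance D ν) (π : D) {lam : ℝ} (h0 : 0 ≤ lam)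
    (h1 : lam ≤ 1) : ratioMoment lam f g π ≤ 1 := by
  refine (ratioMoment_le_lintegral f g π h0).trans
    ((ENNReal.lintegral_mul_norm_pow_le (f.measurable_density π).aemeasurable
      (g.measurable_density π).aemeasurable (sub_nonneg.2 h1) h0 (by ring)).trans_eq ?_)
  simp only [f.lintegral_density, g.lintegral_density, ENNReal.one_rpow, one_mul]

theorem ratioMoment_le_exp (f g : Instance D ν) (π : D) {lam : ℝ} (h0 : 0 < lam) {m : ℝ}
    (hm : (m : EReal) ≤ renyi (1 - lam) f g π) :
    ratioMoment lam f g π ≤ ENNReal.ofReal (Real.exp (-(lam * m))) := by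
  refine (ratioMoment_le_lintegral f g π h0.le).trans ?_
  rw [renyi, sub_sub_cancel, sub_sub_cancel_left, inv_neg] at hm
  set I := ∫⁻ o, f.density π o ^ (1 - lam) * g.density π o ^ lam ∂ν
  rcases eq_or_ne I 0 with hI | hI
  · simp [hI]
  have hneg : -lam⁻¹ < 0 := neg_neg_of_pos (inv_pos.2 h0)
  have hI' : I ≠ ∞ := by
    intro hI'
    rw [hI', ENNReal.log_top, EReal.coe_mul_top_of_neg hneg] at hm
    exact EReal.coe_ne_bot _ (le_bot_iff.1 hm)
  have hpos : 0 < I.toReal := ENNReal.toReal_pos hI hI'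
  rw [← ENNReal.ofReal_toReal hI', ENNReal.log_ofReal_of_pos hpos, ← EReal.coe_mul,
    EReal.coe_le_coe_iff, neg_mul, ← mul_neg, ← div_eq_inv_mul, le_div_iff₀' h0] at hm
  rw [← ENNReal.ofReal_toReal hI']
  exact ENNReal.ofReal_le_ofReal ((Real.log_le_iff_le_exp hpos).1 (by linarith))

theorem ratioMoment_le_exp_truncKL (f g : Instance D ν) (π : D) {lam ε α : ℝ}
    (h0 : 0 < lam) (h1 : lam ≤ 1) (hε : 0 ≤ ε) (hα : 0 ≤ α)
    (h : min ((kl f g π : EReal) - (ε : EReal)) (α : EReal) ≤ renyi (1 - lam) f g π) :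
    ratioMoment lam f g π ≤ ENNReal.ofReal (Real.exp (-(lam * truncKL f g ε α π))) := by
  rcases eq_or_ne (kl f g π) ∞ with hk | hk
  · rw [truncKL_of_eq_top hk ε hα]
    exact ratioMoment_le_exp f g π h0 (le_trans (by simp [hk]) h)
  rw [truncKL_of_ne_top hk hε]
  rcases le_total 0 (min ((kl f g π).toReal - ε) α) with hm | hm
  · rw [max_eq_left hm]
    refine ratioMoment_le_exp f g π h0 (le_of_eq_of_le ?_ h)
    rw [EReal.coe_strictMono.monotone.map_min, EReal.coe_sub, EReal.coe_ennreal_toReal hk]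
  · rw [max_eq_right hm]
    simpa using ratioMoment_le_one f g π h0.le h1

theorem two_mul_rpow_half_mul_le {a b : ℝ≥0∞} (ha : a ≠ ∞) (hb : b ≠ ∞) :
    2 * (a ^ (1 / 2 : ℝ) * b ^ (1 / 2 : ℝ)) ≤ a + b ∧
      (2 * (a ^ (1 / 2 : ℝ) * b ^ (1 / 2 : ℝ)) = a + b → a = b) := by
  lift a to ℝ≥0 using ha
  lift b to ℝ≥0 using hb
  rw [← ENNReal.coe_rpow_of_nonneg a (by norm_num), ← ENNReal.coe_rpow_of_nonneg b (by norm_num)]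
  norm_cast
  rw [← NNReal.sqrt_eq_rpow, ← NNReal.sqrt_eq_rpow, ← mul_assoc]
  obtain ⟨x, rfl⟩ : ∃ x : ℝ≥0, a = x ^ 2 := ⟨NNReal.sqrt a, (NNReal.sq_sqrt a).symm⟩
  obtain ⟨y, rfl⟩ : ∃ y : ℝ≥0, b = y ^ 2 := ⟨NNReal.sqrt b, (NNReal.sq_sqrt b).symm⟩
  rw [NNReal.sqrt_sq, NNReal.sqrt_sq]
  refine ⟨two_mul_le_add_sq x y, fun h => ?_⟩
  have h' : 2 * (x : ℝ) * y = x ^ 2 + y ^ 2 := by exact_mod_cast h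
  have hxy : (x : ℝ) - y = 0 := pow_eq_zero_iff two_ne_zero |>.1 (by linear_combination -h')
  rw [NNReal.eq (sub_eq_zero.1 hxy)]

theorem ratioMoment_half_lt_one {f g : Instance D ν} {π : D} (h : f.law π ≠ g.law π) :
    ratioMoment (1 / 2) f g π < 1 := by
  refine lt_of_le_of_ne (ratioMoment_le_one f g π (by norm_num) (by norm_num)) fun heq => h ?_
  set affinity : O → ℝ≥0∞ := fun o => f.density π o ^ (1 / 2 : ℝ) * g.density π o ^ (1 / 2 : ℝ)
  have affinity_meas : Measurable affinity :=
    ((f.measurable_density π).pow_const _).mul ((g.measurable_density π).pow_const _)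
  have one_le : 1 ≤ ∫⁻ o, affinity o ∂ν := by
    refine heq.symm.le.trans ((ratioMoment_le_lintegral f g π (by norm_num)).trans_eq ?_)
    norm_num [affinity]
  have sum_eq : ∫⁻ o, (f.density π o + g.density π o) ∂ν = 2 := by
    rw [lintegral_add_left (f.measurable_density π), f.lintegral_density, g.lintegral_density,
      one_add_one_eq_two]
  have am_gm (o : O) := two_mul_rpow_half_mul_le (f.density_ne_top π o) (g.density_ne_top π o)
  have mul_eq : (fun o => 2 * affinity o) =ᵐ[ν] fun o => f.density π o + g.density π o := by
    refine ae_eq_of_ae_le_of_lintegral_le (ae_of_all _ fun o => (am_gm o).1) ?_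
      ((f.measurable_density π).add (g.measurable_density π)).aemeasurable ?_
    · exact ((lintegral_mono fun o => (am_gm o).1).trans_lt (sum_eq ▸ ENNReal.ofNat_lt_top)).ne
    · rw [sum_eq, lintegral_const_mul _ affinity_meas]
      exact le_mul_of_one_le_right' one_le
  exact withDensity_congr_ae (mul_eq.mono fun o ho => (am_gm o).2 ho)

theorem exists_ratioMoment_half_le [Finite D] (F : Finset (Instance D ν)) :
    ∃ c > 0, ∀ f ∈ F, ∀ g ∈ F, ∀ π, f.law π ≠ g.law π →
      ratioMoment (1 / 2) f g π ≤ ENNReal.ofReal (Real.exp (-c)) := by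
  have exp_neg_tendsto : Tendsto (fun c : ℝ => ENNReal.ofReal (Real.exp (-c))) (𝓝[>] 0) (𝓝 1) := by
    have exp_cont : Continuous fun c : ℝ => ENNReal.ofReal (Real.exp (-c)) :=
      ENNReal.continuous_ofReal.comp (by fun_prop)
    simpa using (exp_cont.tendsto 0).mono_left nhdsWithin_le_nhds
  have small_rate : ∀ᶠ c in 𝓝[>] (0 : ℝ), ∀ f ∈ F, ∀ g ∈ F, ∀ π, f.law π ≠ g.law π →
      ratioMoment (1 / 2) f g π ≤ ENNReal.ofReal (Real.exp (-c)) := by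
    simp only [Finset.eventually_all, eventually_all]
    intro f _ g _ π h
    filter_upwards [exp_neg_tendsto.eventually_const_lt (ratioMoment_half_lt_one h)] with c hc
    exact hc.le
  obtain ⟨c, hc, hpos⟩ := (small_rate.and self_mem_nhdsWithin).exists
  exact ⟨c, hpos, hc⟩

theorem UniformRenyiConvergence.eventually_ratioMoment_le {F : Finset (Instance D ν)}
    (hF : UniformRenyiConvergence F) {K : ℝ} (hK : 0 < K) :
    ∃ A > (0 : ℝ), ∃ q > (0 : ℝ), ∀ᶠ N : ℝ in atTop, A * N ^ (-q) ∈ Set.Ioo (0 : ℝ) 1 ∧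
      ∀ f ∈ F, ∀ g ∈ F, ∀ π, ratioMoment (A * N ^ (-q)) f g π ≤
        ENNReal.ofReal (Real.exp (-(A * N ^ (-q) *
          truncKL f g (1 / (K * N ^ 2)) (2 * N) π))) := by
  obtain ⟨c₁, c₂, c₃, ι, lam₀, hc₁, hc₂, hc₃, hι, H⟩ := hF
  obtain ⟨ι₀, hι₀, hle⟩ : ∃ ι₀ : ℝ, 0 < ι₀ ∧ ∀ f ∈ F, ι₀ ≤ ι f := by
    rcases F.eq_empty_or_nonempty with rfl | hne
    · exact ⟨1, one_pos, by simp⟩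
    · obtain ⟨f, hf, hmin⟩ := F.exists_min_image ι hne
      exact ⟨ι f, hι f hf, hmin⟩
  have hq : 0 < 2 * c₁ + c₃ := by positivity
  have step_tendsto := (tendsto_rpow_neg_atTop hq).const_mul (K⁻¹ ^ c₁ * 2⁻¹ ^ c₃ * ι₀)
  rw [mul_zero] at step_tendsto
  refine ⟨K⁻¹ ^ c₁ * 2⁻¹ ^ c₃ * ι₀, by positivity, 2 * c₁ + c₃, hq, ?_⟩
  have sq_tendsto : Tendsto (fun N : ℝ => K * N ^ 2) atTop atTop :=
    (tendsto_pow_atTop two_ne_zero).const_mul_atTop hK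
  filter_upwards [eventually_gt_atTop 0, step_tendsto.eventually_lt_const one_pos,
    sq_tendsto.eventually_gt_atTop 1, (tendsto_const_nhds.div_atTop
      (tendsto_id.const_mul_atTop two_pos) : Tendsto (fun N : ℝ => 1 / (2 * N)) atTop
        (𝓝 0)).eventually_le_const hc₂] with N hN step_lt_one sq_gt_one inv_le
  have step_pos : 0 < K⁻¹ ^ c₁ * 2⁻¹ ^ c₃ * ι₀ * N ^ (-(2 * c₁ + c₃)) := by positivity
  refine ⟨⟨step_pos, step_lt_one⟩, fun f hf g hg π => ?_⟩
  have hε : 1 / (K * N ^ 2) < 1 := (div_lt_one (by positivity)).2 sq_gt_one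
  obtain ⟨lam₀_ge, renyi_ge⟩ := H (2 * N) (by positivity) _ (by positivity) hε f hf
  refine ratioMoment_le_exp_truncKL f g π step_pos step_lt_one.le (by positivity) (by positivity)
    (renyi_ge _ step_pos step_lt_one (le_trans ?_ lam₀_ge) g hg π)
  rw [min_eq_left inv_le]
  calc K⁻¹ ^ c₁ * 2⁻¹ ^ c₃ * ι₀ * N ^ (-(2 * c₁ + c₃))
      = (1 / (K * N ^ 2)) ^ c₁ * (1 / (2 * N)) ^ c₃ * ι₀ := by
        rw [one_div, mul_inv, Real.mul_rpow (by positivity) (by positivity), one_div, mul_inv,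
          Real.mul_rpow (by positivity) (by positivity), Real.inv_rpow (sq_nonneg N) c₁,
          ← Real.rpow_natCast_mul hN.le, Real.inv_rpow hN.le c₃, neg_add, Real.rpow_add hN,
          Real.rpow_neg hN.le, Real.rpow_neg hN.le]
        push_cast
        ring
    _ ≤ (1 / (K * N ^ 2)) ^ c₁ * (1 / (2 * N)) ^ c₃ * ι f := by
        gcongr
        exact hle f hf

end RatioMoment

/-! ### Laws of infinite records of play -/

section Record

variable {D O : Type*}

/-- The first `t` rounds of the infinite record of play `H`. -/
abbrev past (H : ℕ → D × O) (t : ℕ) : History D O t := fun i => H i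

/-- A history continued by arbitrary rounds. Working with functions on `ℕ` avoids casts between
histories of different lengths. -/
def extend [Nonempty (D × O)] {t : ℕ} (h : History D O t) : ℕ → D × O :=
  fun i => if hi : i < t then h ⟨i, hi⟩ else Classical.arbitrary _

theorem past_update {t n : ℕ} (htn : t ≤ n) (H : ℕ → D × O) (x : D × O) :
    past (Function.update H n x) t = past H t :=
  funext fun i => Function.update_of_ne (i.2.trans_le htn).ne x H

section Extend

variable [Nonempty (D × O)]

theorem past_extend {t : ℕ} (h : History D O t) : past (extend h) t = h := by
  funext i
  simp [extend]

theorem extend_snoc {t : ℕ} (h : History D O t) (x : D × O) :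
    extend (Fin.snoc (α := fun _ => D × O) h x : History D O (t + 1)) =
      Function.update (extend h) t x := by
  funext i
  rcases lt_trichotomy i t with hi | rfl | hi
  · simp [extend, Fin.snoc, hi, hi.trans t.lt_succ_self, hi.ne]
  · simp [extend, Fin.snoc]
  · simp [extend, hi.not_gt, hi.ne', Nat.not_lt.2 (Nat.succ_le_of_lt hi)]

theorem measurable_extend [MeasurableSpace D] [MeasurableSpace O] (t : ℕ) :
    Measurable (extend : History D O t → ℕ → D × O) := by
  refine measurable_pi_iff.2 fun i => ?_
  by_cases hi : i < t
  · simpa only [extend, hi, dif_pos] using measurable_pi_apply (⟨i, hi⟩ : Fin t)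
  · simp only [extend, hi, dif_neg, not_false_eq_true, measurable_const]

end Extend

variable [MeasurableSpace D] [MeasurableSpace O]

theorem measurable_past (t : ℕ) : Measurable fun H : ℕ → D × O => past H t :=
  measurable_pi_iff.2 fun _ => measurable_pi_apply _

theorem measurable_act_past (A : Policy D O) (t : ℕ) :
    Measurable fun H : ℕ → D × O => A.act t (past H t) :=
  (A.measurable_act t).comp (measurable_past t)

variable [Countable D] [DiscreteMeasurableSpace D]

theorem measurable_round {β : Type*} [MeasurableSpace β] {φ : D → O → β}
    (hφ : ∀ d, Measurable (φ d)) (i : ℕ) :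
    Measurable fun H : ℕ → D × O => φ (H i).1 (H i).2 :=
  (measurable_from_prod_countable_right (f := fun p : D × O => φ p.1 p.2) hφ).comp
    (measurable_pi_apply i)

theorem measurable_prod_rounds {φ : ℕ → D → O → ℝ≥0∞} (hm : ∀ t d, Measurable (φ t d)) (n : ℕ) :
    Measurable fun H : ℕ → D × O => ∏ i ∈ Finset.range n, φ i (H i).1 (H i).2 :=
  Finset.measurable_prod _ fun i _ => measurable_round (hm i) i

end Record

section PathLaw

variable {D O : Type*} [MeasurableSpace O] {ν : Measure O}

theorem measurable_snoc {α : Type*} [MeasurableSpace α] (t : ℕ) :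
    Measurable fun p : (Fin t → α) × α =>
      (Fin.snoc (α := fun _ => α) p.1 p.2 : Fin (t + 1) → α) := by
  refine measurable_pi_iff.2 fun i => ?_
  refine Fin.lastCases ?_ (fun j => ?_) i
  · simpa only [Fin.snoc_last] using measurable_snd
  · simp only [Fin.snoc_castSucc]
    exact (measurable_pi_apply j).comp measurable_fst

/-- The law of the first `n` rounds of policy `A` on the instance `f`, continued by arbitrary
rounds. -/
def pathLaw [Nonempty (D × O)] [MeasurableSpace D] (f : Instance D ν) (A : Policy D O) (n : ℕ) :
    Measure (ℕ → D × O) :=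
  (historyLaw f A n).map extend

theorem historyLaw_congr [MeasurableSpace D] {f g : Instance D ν} (h : f.law = g.law)
    (A : Policy D O) (t : ℕ) : historyLaw f A t = historyLaw g A t := by
  induction t with
  | zero => rfl
  | succ t ih => simp only [historyLaw, ih, h]

theorem measurable_historyLaw_step [MeasurableSpace D] [Countable D] [DiscreteMeasurableSpace D]
    (f : Instance D ν) (A : Policy D O) (t : ℕ) :
    Measurable fun h : History D O t =>
      (f.law (A.act t h)).map fun o => Fin.snoc (α := fun _ => D × O) h (A.act t h, o) := by
  have joint : Measurable fun p : History D O t × D => (f.law p.2).map fun o =>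
      (Fin.snoc (α := fun _ => D × O) p.1 (p.2, o) : History D O (t + 1)) := by
    refine measurable_from_prod_countable_left fun d => ?_
    have snoc_meas : Measurable fun p : History D O t × O =>
        (Fin.snoc (α := fun _ => D × O) p.1 (d, p.2) : History D O (t + 1)) :=
      (measurable_snoc t).comp (measurable_fst.prodMk (measurable_const.prodMk measurable_snd))
    convert (Measure.measurable_map _ snoc_meas).comp
      (Measurable.map_prodMk_left (α := History D O t) (ν := f.law d)) using 2 with h
    exact (Measure.map_map snoc_meas measurable_prodMk_left).symm
  exact joint.comp (measurable_id.prodMk (A.measurable_act t))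

theorem lintegral_historyLaw_succ [MeasurableSpace D] [Countable D] [DiscreteMeasurableSpace D]
    (f : Instance D ν) (A : Policy D O) (t : ℕ)
    {G : History D O (t + 1) → ℝ≥0∞} (hG : Measurable G) :
    ∫⁻ h, G h ∂(historyLaw f A (t + 1)) = ∫⁻ h, ∫⁻ o,
      G (Fin.snoc (α := fun _ => D × O) h (A.act t h, o)) ∂(f.law (A.act t h))
        ∂(historyLaw f A t) := by
  rw [historyLaw, Measure.lintegral_bind (measurable_historyLaw_step f A t).aemeasurable
    hG.aemeasurable]
  refine lintegral_congr fun h => lintegral_map hG ?_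
  exact (measurable_snoc t).comp (measurable_const.prodMk (measurable_const.prodMk measurable_id))

variable [Nonempty (D × O)]

variable [MeasurableSpace D]

theorem pathLaw_congr {f g : Instance D ν} (h : f.law = g.law) (A : Policy D O) (n : ℕ) :
    pathLaw f A n = pathLaw g A n := by
  rw [pathLaw, historyLaw_congr h, pathLaw]

theorem lintegral_pathLaw (f : Instance D ν) (A : Policy D O) (n : ℕ)
    {G : (ℕ → D × O) → ℝ≥0∞} (hG : Measurable G) :
    ∫⁻ H, G H ∂(pathLaw f A n) = ∫⁻ h, G (extend h) ∂(historyLaw f A n) :=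
  lintegral_map hG (measurable_extend n)

variable [Countable D] [DiscreteMeasurableSpace D]

theorem lintegral_pathLaw_succ (f : Instance D ν) (A : Policy D O) (n : ℕ)
    {G : (ℕ → D × O) → ℝ≥0∞} (hG : Measurable G) :
    ∫⁻ H, G H ∂(pathLaw f A (n + 1)) = ∫⁻ H, ∫⁻ o,
      G (Function.update H n (A.act n (past H n), o)) ∂(f.law (A.act n (past H n)))
        ∂(pathLaw f A n) := by
  have inner_meas : Measurable fun H : ℕ → D × O => ∫⁻ o,
      G (Function.update H n (A.act n (past H n), o)) ∂(f.law (A.act n (past H n))) := by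
    have joint : Measurable fun p : (ℕ → D × O) × D =>
        ∫⁻ o, G (Function.update p.1 n (p.2, o)) ∂(f.law p.2) :=
      measurable_from_prod_countable_left fun d => Measurable.lintegral_prod_right'
        (ν := f.law d) (f := fun q : (ℕ → D × O) × O => G (Function.update q.1 n (d, q.2)))
        (hG.comp (by fun_prop))
    exact (joint.comp (measurable_id.prodMk (measurable_act_past A n)) :)
  rw [lintegral_pathLaw f A _ hG, lintegral_pathLaw f A _ inner_meas,
    lintegral_historyLaw_succ f A n (G := fun h => G (extend h)) (hG.comp (measurable_extend _))]
  simp only [extend_snoc, past_extend]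

instance isProbabilityMeasure_pathLaw (f : Instance D ν) (A : Policy D O) (n : ℕ) :
    IsProbabilityMeasure (pathLaw f A n) := by
  induction n with
  | zero =>
    rw [pathLaw, historyLaw]
    exact Measure.isProbabilityMeasure_map (measurable_extend 0).aemeasurable
  | succ n ih =>
    constructor
    simpa using lintegral_pathLaw_succ f A n (G := fun _ => 1) measurable_const

theorem ae_pathLaw_succ {f : Instance D ν} {A : Policy D O} {n : ℕ} {P : (ℕ → D × O) → Prop}
    (hP : MeasurableSet {H | P H})
    (h : ∀ᵐ H ∂(pathLaw f A n), ∀ᵐ o ∂(f.law (A.act n (past H n))),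
      P (Function.update H n (A.act n (past H n), o))) :
    ∀ᵐ H ∂(pathLaw f A (n + 1)), P H := by
  rw [ae_iff, ← Set.compl_ofPred, ← lintegral_indicator_one hP.compl,
    lintegral_pathLaw_succ f A n (measurable_one.indicator hP.compl)]
  refine (lintegral_congr_ae (g := 0) ?_).trans lintegral_zero
  filter_upwards [h] with H hH
  refine (lintegral_congr_ae (g := 0) ?_).trans lintegral_zero
  filter_upwards [hH] with o ho
  exact Set.indicator_of_notMem (Set.notMem_compl_iff.2 ho) _

theorem ae_pathLaw (f : Instance D ν) (A : Policy D O) {P : D → O → Prop}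
    (hm : ∀ d, MeasurableSet {o | P d o}) (hP : ∀ d, ∀ᵐ o ∂(f.law d), P d o) (n : ℕ) :
    ∀ᵐ H ∂(pathLaw f A n), ∀ t < n, P (H t).1 (H t).2 ∧ (H t).1 = A.act t (past H t) := by
  have round_meas (t : ℕ) :
      MeasurableSet {H : ℕ → D × O | P (H t).1 (H t).2 ∧ (H t).1 = A.act t (past H t)} :=
    (measurableSet_setOfPred.2
      (measurable_round (fun d => measurableSet_setOfPred.1 (hm d)) t)).inter
      (measurableSet_eq_fun (measurable_fst.comp (measurable_pi_apply t))
        (measurable_act_past A t))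
  induction n with
  | zero => exact ae_of_all _ fun H t ht => absurd ht t.not_lt_zero
  | succ n ih =>
    refine ae_pathLaw_succ ?_ ?_
    · simp only [Set.ofPred_forall]
      exact MeasurableSet.iInter fun t => MeasurableSet.iInter fun _ => round_meas t
    filter_upwards [ih] with H hH
    filter_upwards [hP (A.act n (past H n))] with o ho t ht
    rw [past_update (Nat.lt_succ_iff.1 ht)]
    rcases (Nat.lt_succ_iff.1 ht).lt_or_eq with htn | rfl
    · rw [Function.update_of_ne htn.ne]
      exact hH t htn
    · rw [Function.update_self]
      exact ⟨ho, rfl⟩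

theorem lintegral_prod_pathLaw_le_one (f : Instance D ν) (A : Policy D O)
    {φ : ℕ → D → O → ℝ≥0∞} (hm : ∀ t d, Measurable (φ t d))
    (hφ : ∀ t d, ∫⁻ o, φ t d o ∂(f.law d) ≤ 1) (n : ℕ) :
    ∫⁻ H, ∏ i ∈ Finset.range n, φ i (H i).1 (H i).2 ∂(pathLaw f A n) ≤ 1 := by
  induction n with
  | zero => simp
  | succ n ih =>
    rw [lintegral_pathLaw_succ f A n (measurable_prod_rounds hm _)]
    refine (lintegral_mono fun H => ?_).trans ih
    have prod_update (o : O) : ∏ i ∈ Finset.range n,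
        φ i (Function.update H n (A.act n (past H n), o) i).1
          (Function.update H n (A.act n (past H n), o) i).2 =
        ∏ i ∈ Finset.range n, φ i (H i).1 (H i).2 :=
      Finset.prod_congr rfl fun i hi => by
        rw [Function.update_of_ne (Finset.mem_range.1 hi).ne]
    simp only [Finset.prod_range_succ, prod_update, Function.update_self]
    rw [lintegral_const_mul _ (hm _ _)]
    exact mul_le_of_le_one_right' (hφ _ _)

theorem pathLaw_real_exp_le_prod_le (f : Instance D ν) (A : Policy D O)
    {φ : ℕ → D → O → ℝ≥0∞} (hm : ∀ t d, Measurable (φ t d))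
    (hφ : ∀ t d, ∫⁻ o, φ t d o ∂(f.law d) ≤ 1) (n : ℕ) (r : ℝ) :
    (pathLaw f A n).real {H | ENNReal.ofReal (Real.exp r) ≤
      ∏ i ∈ Finset.range n, φ i (H i).1 (H i).2} ≤ Real.exp (-r) := by
  refine ENNReal.toReal_le_of_le_ofReal (Real.exp_pos _).le ?_
  refine (meas_ge_le_lintegral_div (measurable_prod_rounds hm n).aemeasurable
    (by simp [Real.exp_pos]) ENNReal.ofReal_ne_top).trans ?_
  refine (ENNReal.div_le_div_right (lintegral_prod_pathLaw_le_one f A hm hφ n) _).trans_eq ?_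
  rw [one_div, ← ENNReal.ofReal_inv_of_pos (Real.exp_pos r), Real.exp_neg]

end PathLaw

section Regret

variable {D O : Type*} [MeasurableSpace O] {ν : Measure O} [Finite D] [Nonempty D]
  [MeasurableSpace D] [DiscreteMeasurableSpace D]

theorem measurable_sum_gap (R : O → ℝ) (f : Instance D ν) (s : Finset ℕ) :
    Measurable fun H : ℕ → D × O => ∑ i ∈ s, gap R f (H i).1 :=
  Finset.measurable_fun_sum s fun i _ =>
    (Measurable.of_discrete (f := gap R f)).comp (measurable_fst.comp (measurable_pi_apply i))

theorem integrable_sum_gap {R : O → ℝ} {Rmax : ℝ} {f : Instance D ν}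
    (hle : ∀ π, gap R f π ≤ Rmax) (s : Finset ℕ) (μ : Measure (ℕ → D × O)) [IsFiniteMeasure μ] :
    Integrable (fun H => ∑ i ∈ s, gap R f (H i).1) μ :=
  Integrable.of_mem_Icc 0 (s.card * Rmax) (measurable_sum_gap R f s).aemeasurable (ae_of_all _
    fun H => ⟨Finset.sum_nonneg fun _ _ => gap_nonneg R f _,
      sum_gap_le_card_mul hle s fun i => (H i).1⟩)

variable [Nonempty (D × O)]

theorem regret_eq_integral_pathLaw (R : O → ℝ) (f : Instance D ν) (A : Policy D O) (n : ℕ) :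
    regret R f A n =
      ∫ H, ∑ i ∈ Finset.range n, gap R f (H i).1 ∂(pathLaw f A n) := by
  rw [pathLaw, integral_map (measurable_extend n).aemeasurable
    (measurable_sum_gap R f _).aestronglyMeasurable, regret]
  refine integral_congr_ae (ae_of_all _ fun h => ?_)
  simp only [Finset.sum_range, iSup_meanReward, extend, Fin.is_lt, dif_pos, Fin.eta, gap]

theorem regret_nonpos_of_gap_nonpos {R : O → ℝ} {f : Instance D ν} (h : ∀ π, gap R f π ≤ 0)
    (A : Policy D O) (n : ℕ) : regret R f A n ≤ 0 := by
  rw [regret_eq_integral_pathLaw]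
  exact integral_nonpos fun H => Finset.sum_nonpos fun i _ => h (H i).1

end Regret

/-! ### The complexity measure -/

section Complexity

variable {D O : Type*} [MeasurableSpace O] {ν : Measure O}

/-- The number of plays per unit of `ln n` in the identification step: the weights `w`, scaled up
slightly and mixed with the uniform weights. -/
def mixedWeight (N : ℝ) (w : D → ℝ≥0) (π : D) : ℝ := (1 + 1 / N) * w π + 1 / N

theorem mixedWeight_nonneg {N : ℝ} (hN : 0 ≤ N) (w : D → ℝ≥0) (π : D) :
    0 ≤ mixedWeight N w π := by
  rw [mixedWeight]
  positivity

theorem sub_le_truncKL {f g : Instance D ν} {π : D} {ε α : ℝ} (hε : 0 ≤ ε) (hα : 0 ≤ α)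
    (h : truncKL f g ε α π ≠ α) :
    kl f g π ≠ ∞ ∧ (kl f g π).toReal - ε ≤ truncKL f g ε α π := by
  have kl_ne_top : kl f g π ≠ ∞ := fun hk => h (truncKL_of_eq_top hk ε hα)
  rw [truncKL_of_ne_top kl_ne_top hε] at h ⊢
  grind

variable [Fintype D] [Nonempty D]

theorem cost_congr (R : O → ℝ) {f g : Instance D ν} (h : f.law = g.law) :
    cost R f = cost R g := by
  funext w
  simp only [cost, gap_congr R h]

theorem isFeasible_congr (R : O → ℝ) (F : Finset (Instance D ν)) {f g : Instance D ν}
    (h : f.law = g.law) : IsFeasible R F f = IsFeasible R F g := by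
  funext N w
  simp only [IsFeasible, optDecision_congr R h, kl_congr h]

theorem isSolution_congr (R : O → ℝ) (F : Finset (Instance D ν)) {f g : Instance D ν}
    (h : f.law = g.law) : IsSolution R F f = IsSolution R F g := by
  funext N η w
  simp only [IsSolution, isFeasible_congr R F h, cost_congr R h]

theorem cost_nonneg (R : O → ℝ) (f : Instance D ν) (w : D → ℝ≥0) : 0 ≤ cost R f w :=
  Finset.sum_nonneg fun π _ => mul_nonneg (w π).2 (gap_nonneg R f π)

theorem complexityAt_nonneg (R : O → ℝ) (F : Finset (Instance D ν)) (f : Instance D ν) (N : ℝ) :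
    0 ≤ complexityAt R F f N :=
  le_iInf₂ fun w _ => EReal.coe_nonneg.2 (cost_nonneg R f w)

theorem antitone_complexityAt (R : O → ℝ) (F : Finset (Instance D ν)) (f : Instance D ν) :
    Antitone (complexityAt R F f) :=
  fun _ _ hN => le_iInf₂ fun w hw => iInf₂_le w ⟨hw.1, fun π => (hw.2 π).trans hN⟩

theorem tendsto_complexityAt (R : O → ℝ) (F : Finset (Instance D ν)) (f : Instance D ν) :
    Tendsto (complexityAt R F f) atTop (𝓝 (complexity R F f)) := by
  have tendsto_iInf := tendsto_atTop_iInf (antitone_complexityAt R F f)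
  rwa [complexity, tendsto_iInf.limUnder_eq]

theorem complexity_nonneg (R : O → ℝ) (F : Finset (Instance D ν)) (f : Instance D ν) :
    0 ≤ complexity R F f :=
  ge_of_tendsto' (tendsto_complexityAt R F f) (complexityAt_nonneg R F f)

theorem complexity_ne_bot (R : O → ℝ) (F : Finset (Instance D ν)) (f : Instance D ν) :
    complexity R F f ≠ ⊥ :=
  (EReal.bot_lt_zero.trans_le (complexity_nonneg R F f)).ne'

theorem eventually_exists_isFeasible (R : O → ℝ) (F : Finset (Instance D ν)) :
    ∀ᶠ N : ℝ in atTop, ∀ f ∈ F, ∃ w, IsFeasible R F f N w := by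
  have constraint : ∀ f ∈ F, ∀ g ∈ F, ∀ᶠ N : ℝ in atTop,
      optDecision R g ≠ optDecision R f → 1 ≤ ∑ π, (N.toNNReal : ℝ≥0∞) * kl f g π := by
    intro f _ g _
    by_cases hne : optDecision R g = optDecision R f
    · exact Eventually.of_forall fun N hc => absurd hne hc
    obtain ⟨π, hπ⟩ := exists_kl_ne_zero fun h => hne (optDecision_congr R h).symm
    have mul_tendsto : Tendsto (fun N : ℝ => (N.toNNReal : ℝ≥0∞) * kl f g π) atTop (𝓝 ∞) := by
      rw [← ENNReal.top_mul hπ]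
      exact ENNReal.Tendsto.mul_const
        (ENNReal.tendsto_coe_nhds_top.2 tendsto_real_toNNReal_atTop) (Or.inl ENNReal.top_ne_zero)
    filter_upwards [mul_tendsto.eventually (lt_mem_nhds ENNReal.one_lt_top)] with N hN _
    exact hN.le.trans (Finset.single_le_sum (f := fun π => (N.toNNReal : ℝ≥0∞) * kl f g π)
      (fun _ _ => zero_le) (Finset.mem_univ π))
  have constraints := F.eventually_all.2 fun f hf => F.eventually_all.2 fun g => constraint f hf g
  filter_upwards [constraints, eventually_ge_atTop 0] with N hN hN0 f hf
  exact ⟨fun _ => N.toNNReal, hN f hf, fun _ => (Real.coe_toNNReal N hN0).le⟩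

theorem complexity_ne_top (R : O → ℝ) {F : Finset (Instance D ν)} {f : Instance D ν}
    (hf : f ∈ F) : complexity R F f ≠ ⊤ := by
  obtain ⟨N, hN⟩ := (eventually_exists_isFeasible R F).exists
  obtain ⟨w, hw⟩ := hN f hf
  have le_at : complexity R F f ≤ complexityAt R F f N :=
    (antitone_complexityAt R F f).le_of_tendsto (tendsto_complexityAt R F f) N
  exact ((le_at.trans (iInf₂_le w hw)).trans_lt (EReal.coe_lt_top _)).ne

theorem cost_le_of_isSolution {R : O → ℝ} {F : Finset (Instance D ν)} {f : Instance D ν} {N : ℝ}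
    {η : ℝ≥0} {w : D → ℝ≥0} (h : IsSolution R F f N η w) :
    cost R f w ≤ (complexityAt R F f N).toReal + η := by
  have at_le : complexityAt R F f N ≤ (cost R f w : EReal) := iInf₂_le w h.1
  have le_at : ((cost R f w - η : ℝ) : EReal) ≤ complexityAt R F f N :=
    le_iInf₂ fun w' hw' => EReal.coe_le_coe_iff.2 (sub_le_iff_le_add.2 (h.2 w' hw'))
  have le_toReal := EReal.toReal_le_toReal le_at (EReal.coe_ne_bot _)
    (at_le.trans_lt (EReal.coe_lt_top _)).ne
  rwa [EReal.toReal_coe, sub_le_iff_le_add] at le_toReal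

theorem one_sub_le_sum_mul_truncKL {R : O → ℝ} {F : Finset (Instance D ν)} {f g : Instance D ν}
    {N : ℝ} {w : D → ℝ≥0} (hw : IsFeasible R F f N w) (hg : g ∈ F)
    (hne : optDecision R g ≠ optDecision R f) {ε α : ℝ} (hε : 0 ≤ ε) (hα : 0 ≤ α)
    (h : ∀ π, truncKL f g ε α π ≠ α) :
    1 - Fintype.card D * N * ε ≤ ∑ π, (w π : ℝ) * truncKL f g ε α π := by
  have kl_ne_top (π : D) : kl f g π ≠ ∞ := (sub_le_truncKL hε hα (h π)).1
  have mul_ne_top (π : D) : (w π : ℝ≥0∞) * kl f g π ≠ ∞ :=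
    ENNReal.mul_ne_top ENNReal.coe_ne_top (kl_ne_top π)
  have one_le : 1 ≤ ∑ π, (w π : ℝ) * (kl f g π).toReal := by
    have one_le_toReal := ENNReal.toReal_mono (ENNReal.sum_ne_top.2 fun π _ => mul_ne_top π)
      (hw.1 g hg hne)
    rw [ENNReal.toReal_sum fun π _ => mul_ne_top π] at one_le_toReal
    simpa using one_le_toReal
  calc
    1 - Fintype.card D * N * ε
        ≤ ∑ π, (w π : ℝ) * (kl f g π).toReal - ∑ _π : D, N * ε := by
      rw [Finset.sum_const, Finset.card_univ, nsmul_eq_mul, ← mul_assoc]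
      gcongr
    _ = ∑ π, ((w π : ℝ) * (kl f g π).toReal - N * ε) := Finset.sum_sub_distrib _ _ |>.symm
    _ ≤ ∑ π, (w π : ℝ) * truncKL f g ε α π := by
      refine Finset.sum_le_sum fun π _ => ?_
      refine le_trans ?_ (mul_le_mul_of_nonneg_left (sub_le_truncKL hε hα (h π)).2 (w π).2)
      rw [mul_sub]
      gcongr
      exact hw.2 π

/-- A decision whose divergence is truncated at `2 * N` satisfies the constraint by itself, because
its weight is at least `1 / N`; if there is none, the truncation only loses the terms in `ε`, and
the factor `1 + 1 / N` makes up for them. -/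
theorem one_add_le_sum_mixedWeight_mul_truncKL {R : O → ℝ} {F : Finset (Instance D ν)}
    {f g : Instance D ν} {N : ℝ} (hN : 1 ≤ N) {w : D → ℝ≥0} (hw : IsFeasible R F f N w)
    (hg : g ∈ F) (hne : optDecision R g ≠ optDecision R f) :
    1 + 1 / (2 * N) ≤ ∑ π, mixedWeight N w π *
      truncKL f g (1 / (4 * Fintype.card D * N ^ 2)) (2 * N) π := by
  have hN0 : 0 < N := one_pos.trans_le hN
  have : (0 : ℝ) < Fintype.card D := by exact_mod_cast Fintype.card_pos
  set ε : ℝ := 1 / (4 * Fintype.card D * N ^ 2)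
  have hε : 0 ≤ ε := by positivity
  have inv_le : 1 / N ≤ 1 := (div_le_one hN0).2 hN
  have half_eq : 1 / (2 * N) = 1 / N / 2 := by field_simp
  by_cases truncated : ∃ π, truncKL f g ε (2 * N) π = 2 * N
  · obtain ⟨π, hπ⟩ := truncated
    calc
      1 + 1 / (2 * N) ≤ 1 / N * (2 * N) := by
        field_simp at half_eq inv_le ⊢
        linarith
      _ ≤ mixedWeight N w π * truncKL f g ε (2 * N) π := by
        rw [hπ, mixedWeight]
        gcongr
        exact le_add_of_nonneg_left (by positivity)
      _ ≤ _ := Finset.single_le_sum (fun π _ => mul_nonneg (mixedWeight_nonneg hN0.le w π)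
          (truncKL_nonneg f g ε _ π)) (Finset.mem_univ π)
  push Not at truncated
  have card_mul_eq : Fintype.card D * N * ε = 1 / N / 4 := by
    simp only [ε]
    field_simp
  calc
    1 + 1 / (2 * N) ≤ (1 + 1 / N) * (1 - Fintype.card D * N * ε) := by
      rw [card_mul_eq, half_eq]
      nlinarith [one_div_pos.2 hN0]
    _ ≤ (1 + 1 / N) * ∑ π, (w π : ℝ) * truncKL f g ε (2 * N) π := by
      gcongr
      exact one_sub_le_sum_mul_truncKL hw hg hne hε (by positivity) truncated
    _ ≤ _ := by
      rw [Finset.mul_sum]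
      refine Finset.sum_le_sum fun π _ => ?_
      rw [← mul_assoc, mixedWeight]
      gcongr
      · exact truncKL_nonneg f g ε _ π
      · exact le_add_of_nonneg_right (by positivity)

end Complexity

/-! ### Likelihood ratios -/

section PlaysList

variable {D O : Type*}

/-- The decisions of the list `l` are played in the rounds from `a` on. -/
def PlaysList (H : ℕ → D × O) (a : ℕ) (l : List D) : Prop :=
  ∀ j (hj : j < l.length), (H (a + j)).1 = l[j]

theorem PlaysList.sum_Ico_eq_sum_count [Fintype D] [DecidableEq D] {H : ℕ → D × O} {a : ℕ}
    {l : List D} (hl : PlaysList H a l) (x : D → ℝ) :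
    ∑ i ∈ Finset.Ico a (a + l.length), x (H i).1 = ∑ π, (l.count π : ℝ) * x π := by
  have apply_eq (i : Fin l.length) : x (H (a + i)).1 = x l[(i : ℕ)] := congrArg x (hl i i.2)
  rw [Finset.sum_Ico_eq_sum_range, Nat.add_sub_cancel_left, Finset.sum_range]
  simp only [apply_eq]
  rw [Fin.sum_univ_fun_getElem, Finset.sum_list_map_count]
  refine (Finset.sum_subset (Finset.subset_univ _) fun π _ hπ => ?_).trans
    (Finset.sum_congr rfl fun π _ => nsmul_eq_mul _ _)
  rw [List.count_eq_zero.2 (by simpa using hπ), zero_smul]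

end PlaysList

section Likelihood

theorem log_prod {ι : Type*} (s : Finset ι) (x : ι → ℝ≥0∞) :
    ENNReal.log (∏ i ∈ s, x i) = ∑ i ∈ s, ENNReal.log (x i) := by
  classical
  induction s using Finset.induction_on with
  | empty => simp
  | insert i s hi ih => rw [Finset.prod_insert hi, Finset.sum_insert hi, ENNReal.log_mul_add, ih]

theorem sum_fin_filter_eq_sum_Ico {M : Type*} [AddCommMonoid M] (x : ℕ → M) {a b t : ℕ}
    (hb : b ≤ t) :
    ∑ i ∈ Finset.univ.filter (fun i : Fin t => a ≤ (i : ℕ) ∧ (i : ℕ) < b), x i =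
      ∑ i ∈ Finset.Ico a b, x i := by
  rw [Finset.sum_filter,
    Fin.sum_univ_eq_sum_range (fun i => if a ≤ i ∧ i < b then x i else 0) t, ← Finset.sum_filter]
  congr 1
  ext i
  simp only [Finset.mem_filter, Finset.mem_range, Finset.mem_Ico]
  omega

variable {D O : Type*} [MeasurableSpace O] {ν : Measure O}

/-- The likelihood ratio of `f` and `g` on the rounds `a ≤ i < b`; its logarithm is
`logLikelihoodRatio`. -/
def likelihoodRatio (f g : Instance D ν) (H : ℕ → D × O) (a b : ℕ) : ℝ≥0∞ :=
  ∏ i ∈ Finset.Ico a b, f.density (H i).1 (H i).2 / g.density (H i).1 (H i).2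

theorem logLikelihood_past (f : Instance D ν) (H : ℕ → D × O) (t : ℕ) :
    logLikelihood f (past H t) =
      ENNReal.log (∏ i ∈ Finset.range t, f.density (H i).1 (H i).2) := by
  rw [log_prod, logLikelihood,
    Fin.sum_univ_eq_sum_range (fun i => ENNReal.log (f.density (H i).1 (H i).2)) t]

theorem logLikelihoodRatio_past (f g : Instance D ν) (H : ℕ → D × O) {a b t : ℕ} (hb : b ≤ t) :
    logLikelihoodRatio f g (past H t) a b = ENNReal.log (likelihoodRatio f g H a b) := by
  rw [likelihoodRatio, log_prod, logLikelihoodRatio]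
  exact sum_fin_filter_eq_sum_Ico
    (fun i => ENNReal.log (f.density (H i).1 (H i).2 / g.density (H i).1 (H i).2)) hb

theorem one_le_likelihoodRatio_of_logLikelihood_le {f g : Instance D ν} {H : ℕ → D × O} {t : ℕ}
    (h : logLikelihood f (past H t) ≤ logLikelihood g (past H t))
    (hf : ∀ i < t, f.density (H i).1 (H i).2 ≠ 0) : 1 ≤ likelihoodRatio g f H 0 t := by
  have hf' : ∀ i ∈ Finset.range t, f.density (H i).1 (H i).2 ≠ 0 :=
    fun i hi => hf i (Finset.mem_range.1 hi)
  rw [logLikelihood_past, logLikelihood_past, ENNReal.log_le_log_iff] at h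
  rw [likelihoodRatio, ← Finset.range_eq_Ico,
    ENNReal.prod_div_distrib fun i hi _ _ _ => Or.inl (hf' i hi),
    ENNReal.le_div_iff_mul_le (Or.inl (Finset.prod_ne_zero_iff.2 hf'))
      (Or.inl (ENNReal.prod_ne_top fun i _ => f.density_ne_top _ _)), one_mul]
  exact h

theorem likelihoodRatio_swap {f g : Instance D ν} {H : ℕ → D × O} {a b : ℕ}
    (hf : ∀ i < b, f.density (H i).1 (H i).2 ≠ 0) :
    likelihoodRatio g f H a b = (likelihoodRatio f g H a b)⁻¹ := by
  have hf' : ∀ i ∈ Finset.Ico a b, f.density (H i).1 (H i).2 ≠ 0 :=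
    fun i hi => hf i (Finset.mem_Ico.1 hi).2
  rw [likelihoodRatio, likelihoodRatio, ENNReal.prod_inv_distrib]
  · refine Finset.prod_congr rfl fun i hi => ?_
    rw [ENNReal.inv_div (Or.inl (g.density_ne_top _ _)) (Or.inr (hf' i hi))]
  · exact fun i hi _ _ _ => Or.inl (ENNReal.div_ne_zero.2 ⟨hf' i hi, g.density_ne_top _ _⟩)

variable [Fintype D] [DecidableEq D] [MeasurableSpace D] [DiscreteMeasurableSpace D]
  [Nonempty (D × O)]

/-- Markov's inequality for the supermartingale with the factors
`(g[π] / f[π]) ^ lam * exp (x π)`. -/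
theorem pathLaw_real_le_likelihoodRatio_rpow_le (f g : Instance D ν) (A : Policy D O) {lam : ℝ}
    (hlam : 0 ≤ lam) {x : D → ℝ}
    (hx : ∀ π, ratioMoment lam f g π ≤ ENNReal.ofReal (Real.exp (-x π))) {n a : ℕ} {l : List D}
    (hn : a + l.length ≤ n) (q : ℝ) :
    (pathLaw f A n).real {H | PlaysList H a l ∧
        ENNReal.ofReal (Real.exp (-q)) ≤ likelihoodRatio g f H a (a + l.length) ^ lam} ≤
      Real.exp (q - ∑ π, (l.count π : ℝ) * x π) := by
  have ratio_meas (d : D) : Measurable fun o => (g.density d o / f.density d o) ^ lam :=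
    ((g.measurable_density d).div (f.measurable_density d)).pow_const _
  set factor : ℕ → D → O → ℝ≥0∞ := fun t d o => if t ∈ Finset.Ico a (a + l.length) then
    (g.density d o / f.density d o) ^ lam * ENNReal.ofReal (Real.exp (x d)) else 1
  have factor_meas (t : ℕ) (d : D) : Measurable (factor t d) :=
    Measurable.ite (MeasurableSet.const _) ((ratio_meas d).mul_const _) measurable_const
  have factor_mean (t : ℕ) (d : D) : ∫⁻ o, factor t d o ∂(f.law d) ≤ 1 := by
    by_cases ht : t ∈ Finset.Ico a (a + l.length)
    · simp only [factor, if_pos ht]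
      rw [lintegral_mul_const _ (ratio_meas d)]
      refine (mul_le_mul_left (hx d) _).trans_eq ?_
      rw [← ENNReal.ofReal_mul (Real.exp_pos _).le, ← Real.exp_add, neg_add_cancel, Real.exp_zero,
        ENNReal.ofReal_one]
    · simp only [factor, if_neg ht]
      simp
  have prod_factor {H : ℕ → D × O} (hl : PlaysList H a l) :
      ∏ i ∈ Finset.range n, factor i (H i).1 (H i).2 =
        likelihoodRatio g f H a (a + l.length) ^ lam *
          ENNReal.ofReal (Real.exp (∑ π, (l.count π : ℝ) * x π)) := by
    rw [Finset.prod_ite_mem, Finset.inter_eq_right.2 fun i hi =>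
        Finset.mem_range.2 ((Finset.mem_Ico.1 hi).2.trans_le hn), Finset.prod_mul_distrib,
      ← ENNReal.ofReal_prod_of_nonneg fun i _ => (Real.exp_pos _).le, ← Real.exp_sum,
      hl.sum_Ico_eq_sum_count, ENNReal.prod_rpow_of_nonneg hlam, likelihoodRatio]
  rw [← neg_sub]
  refine (measureReal_mono fun H hH => ?_).trans
    (pathLaw_real_exp_le_prod_le f A factor_meas factor_mean n _)
  rw [Set.mem_ofPred_eq, prod_factor hH.1, sub_eq_neg_add, Real.exp_add,
    ENNReal.ofReal_mul (Real.exp_pos _).le]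
  gcongr
  exact hH.2

end Likelihood

/-! ### The estimate and the test -/

section Policy

variable {D O : Type*} [MeasurableSpace O] {ν : Measure O} [MeasurableSpace D]

/-- The decisions of the first `n` rounds of `H` are those of the policy `A`. -/
def FollowsPolicy (A : Policy D O) (n : ℕ) (H : ℕ → D × O) : Prop :=
  ∀ t < n, (H t).1 = A.act t (past H t)

theorem ae_pathLaw_followsPolicy_and_density_ne_zero [Countable D] [DiscreteMeasurableSpace D]
    [Nonempty (D × O)] (f : Instance D ν) (A : Policy D O) (n : ℕ) :
    ∀ᵐ H ∂(pathLaw f A n), FollowsPolicy A n H ∧ ∀ t < n, f.density (H t).1 (H t).2 ≠ 0 := by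
  filter_upwards [ae_pathLaw f A
    (fun d => f.measurable_density d (measurableSet_singleton 0).compl)
    f.ae_density_ne_zero n] with H hH
  exact ⟨fun t ht => (hH t ht).2, fun t ht => (hH t ht).1⟩

end Policy

/-- The number of plays of each decision in the initialization step with horizon `n`. -/
def initPlays (n : ℕ) : ℕ := ⌈Real.log n / Real.log (Real.log n)⌉₊

namespace TestToCommit

variable {D O : Type*} [MeasurableSpace O] {ν : Measure O} [Fintype D] [DecidableEq D]
  [Nonempty D] [MeasurableSpace D] {R : O → ℝ} {Rmax : ℝ} {F : Finset (Instance D ν)} {n : ℕ}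
  {η : ℝ≥0}

section Steps

variable (alg : TestToCommit R Rmax F n η)

/-- The maximum likelihood estimate on the record of play `H`. -/
def estimate (H : ℕ → D × O) : F := alg.mle (past H alg.initList.length)

/-- The first round after the identification step if the estimate is `f`. -/
def testEnd (f : F) : ℕ := alg.initList.length + (alg.identList f).length

/-- The estimate passes the test. This is `Accepts` with the likelihood ratios in place of their
logarithms, which makes it independent of the length of the history. -/
def EstimateAccepted (H : ℕ → D × O) : Prop :=
  ∀ g ∈ F, optDecision R g ≠ optDecision R (alg.estimate H : Instance D ν) →
    (n : ℝ≥0∞) ≤ likelihoodRatio (alg.estimate H : Instance D ν) g H alg.initList.length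
      (alg.testEnd (alg.estimate H))

/-- The event that the laws of the estimate are not those of `fstar`. -/
def misestimation (fstar : Instance D ν) : Set (ℕ → D × O) :=
  {H | fstar.law ≠ (alg.estimate H : Instance D ν).law}

/-- The event that an estimate is accepted although its optimal decision is not that of `fstar`. -/
def falseAcceptance (fstar : Instance D ν) : Set (ℕ → D × O) :=
  {H | optDecision R fstar ≠ optDecision R (alg.estimate H : Instance D ν) ∧
    alg.EstimateAccepted H}

/-- The event that an estimate is rejected although its laws are those of `fstar`. -/
def falseRejection (fstar : Instance D ν) : Set (ℕ → D × O) :=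
  {H | fstar.law = (alg.estimate H : Instance D ν).law ∧ ¬ alg.EstimateAccepted H}

theorem accepts_past_iff (hn : 0 < n) {H : ℕ → D × O} {t : ℕ}
    (ht : alg.testEnd (alg.estimate H) ≤ t) :
    Accepts R F n (alg.estimate H : Instance D ν) (past H t) alg.initList.length
      (alg.testEnd (alg.estimate H)) ↔ alg.EstimateAccepted H := by
  simp only [Accepts, EstimateAccepted, logLikelihoodRatio_past _ _ H ht]
  rw [← ENNReal.log_ofReal_of_pos (by exact_mod_cast hn : (0 : ℝ) < n), ENNReal.ofReal_natCast]
  simp only [ENNReal.log_le_log_iff]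

variable {alg} {H : ℕ → D × O}

theorem playsList_initList (hH : FollowsPolicy alg.toPolicy n H)
    (hn : alg.initList.length ≤ n) : PlaysList H 0 alg.initList := by
  intro j hj
  rw [zero_add, hH j (hj.trans_le hn)]
  exact alg.act_init j hj _

theorem playsList_identList (hH : FollowsPolicy alg.toPolicy n H)
    (hn : alg.testEnd (alg.estimate H) ≤ n) :
    PlaysList H alg.initList.length (alg.identList (alg.estimate H)) := by
  intro j hj
  rw [hH _ ((Nat.add_lt_add_left hj _).trans_le hn),
    alg.act_ident _ (Nat.le_add_right _ j) (past H _) (alg.estimate H) rfl (by simpa using hj)]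
  simp only [Nat.add_sub_cancel_left]

variable (alg)

theorem one_add_mul_log_le_sum_count_mul_truncKL {f g : Instance D ν} (hf : f ∈ F) (hg : g ∈ F)
    (hopt : optDecision R g ≠ optDecision R f) (hN : 1 ≤ programBound n)
    (hfeas : ∃ w, IsFeasible R F f (programBound n) w) :
    (1 + 1 / (2 * programBound n)) * Real.log n ≤
      ∑ π, ((alg.identList ⟨f, hf⟩).count π : ℝ) *
        truncKL f g (1 / (4 * Fintype.card D * programBound n ^ 2)) (2 * programBound n) π := by
  have log_nonneg := Real.log_natCast_nonneg n
  refine (mul_le_mul_of_nonneg_right (one_add_le_sum_mixedWeight_mul_truncKL hN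
    (alg.isSolution_weight ⟨f, hf⟩ hfeas).1 hg hopt) log_nonneg).trans ?_
  rw [Finset.sum_mul]
  refine Finset.sum_le_sum fun π _ => ?_
  rw [mul_right_comm, alg.count_identList]
  exact mul_le_mul_of_nonneg_right (Nat.le_ceil _) (truncKL_nonneg _ _ _ _ _)

end Steps

variable [DiscreteMeasurableSpace D] [Nonempty (D × O)] (alg : TestToCommit R Rmax F n η)
  {fstar : Instance D ν}

theorem pathLaw_real_estimate_eq_le (hfstar : fstar ∈ F) (hn : alg.initList.length ≤ n)
    {g : Instance D ν} (hne : fstar.law ≠ g.law) {c : ℝ} (hc : 0 ≤ c)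
    (hsep : ∀ π, fstar.law π ≠ g.law π →
      ratioMoment (1 / 2) fstar g π ≤ ENNReal.ofReal (Real.exp (-c))) :
    (pathLaw fstar alg.toPolicy n).real {H | (alg.estimate H : Instance D ν) = g} ≤
      Real.exp (-(c * initPlays n)) := by
  classical
  set x : D → ℝ := fun π => if fstar.law π = g.law π then 0 else c
  have moment_le (π : D) : ratioMoment (1 / 2) fstar g π ≤ ENNReal.ofReal (Real.exp (-x π)) := by
    by_cases hπ : fstar.law π = g.law π
    · simpa [x, hπ] using ratioMoment_le_one fstar g π (by norm_num) (by norm_num)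
    · simpa only [x, if_neg hπ] using hsep π hπ
  have le_sum : c ≤ ∑ π, x π := by
    obtain ⟨π, hπ⟩ := Function.ne_iff.1 hne
    refine le_of_eq_of_le (if_neg hπ).symm
      (Finset.single_le_sum (f := x) (fun π _ => ?_) (Finset.mem_univ π))
    simp only [x]
    split_ifs <;> simp [hc]
  calc
    _ ≤ (pathLaw fstar alg.toPolicy n).real {H | PlaysList H 0 alg.initList ∧
          ENNReal.ofReal (Real.exp (-0)) ≤
            likelihoodRatio g fstar H 0 (0 + alg.initList.length) ^ (1 / 2 : ℝ)} := by
      refine measureReal_le_of_ae_imp ?_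
      filter_upwards [ae_pathLaw_followsPolicy_and_density_ne_zero fstar alg.toPolicy n]
        with H hH hest
      refine ⟨playsList_initList hH.1 hn, ?_⟩
      rw [neg_zero, Real.exp_zero, ENNReal.ofReal_one, zero_add]
      refine ENNReal.one_le_rpow (one_le_likelihoodRatio_of_logLikelihood_le ?_
        fun i hi => hH.2 i (hi.trans_le hn)) (by norm_num)
      exact hest ▸ alg.isMax_mle (past H alg.initList.length) fstar hfstar
    _ ≤ Real.exp (0 - ∑ π, (alg.initList.count π : ℝ) * x π) :=
      pathLaw_real_le_likelihoodRatio_rpow_le fstar g alg.toPolicy (by norm_num) moment_le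
        (by rwa [zero_add]) 0
    _ ≤ _ := by
      simp only [alg.count_initList, ← Finset.mul_sum, zero_sub, mul_comm c, initPlays]
      gcongr

theorem pathLaw_real_misestimation_le (hfstar : fstar ∈ F) (hn : alg.initList.length ≤ n)
    {c : ℝ} (hc : 0 ≤ c) (hsep : ∀ g ∈ F, ∀ π, fstar.law π ≠ g.law π →
      ratioMoment (1 / 2) fstar g π ≤ ENNReal.ofReal (Real.exp (-c))) :
    (pathLaw fstar alg.toPolicy n).real (alg.misestimation fstar) ≤
      F.card * Real.exp (-(c * initPlays n)) := by
  refine (measureReal_mono (s₂ := {H | ∃ g ∈ F, fstar.law ≠ g.law ∧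
    (alg.estimate H : Instance D ν) = g}) fun H hH => ⟨_, (alg.estimate H).2, hH, rfl⟩).trans
    (measureReal_exists_le_card_mul F fun g hg => ?_)
  by_cases hne : fstar.law = g.law
  · simp [hne, Real.exp_nonneg]
  · simpa [hne] using alg.pathLaw_real_estimate_eq_le hfstar hn hne hc (hsep g hg)

/-- Under `fstar` the likelihood ratio of the estimate and `fstar` has mean at most one, so it
rarely reaches the level `n` of the test. -/
theorem pathLaw_real_falseAcceptance_le (hfstar : fstar ∈ F) (hn : 0 < n)
    (hend : ∀ f, alg.testEnd f ≤ n) :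
    (pathLaw fstar alg.toPolicy n).real (alg.falseAcceptance fstar) ≤ F.card * (1 / n) := by
  have moment_le (g : Instance D ν) (π : D) :
      ratioMoment 1 fstar g π ≤ ENNReal.ofReal (Real.exp (-(0 : D → ℝ) π)) := by
    simpa using ratioMoment_le_one fstar g π zero_le_one le_rfl
  have markov (g : F) := (pathLaw_real_le_likelihoodRatio_rpow_le fstar (g : Instance D ν)
    alg.toPolicy zero_le_one (moment_le g) (hend g) (-Real.log n)).trans_eq
      (by simp [Real.exp_neg, Real.exp_log (by exact_mod_cast hn : (0 : ℝ) < n)] :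
        _ = 1 / (n : ℝ))
  rw [← Fintype.card_coe, ← Finset.card_univ]
  refine (measureReal_le_of_ae_imp ?_).trans
    (measureReal_exists_le_card_mul Finset.univ fun g _ => markov g)
  filter_upwards [ae_pathLaw_followsPolicy_and_density_ne_zero fstar alg.toPolicy n]
    with H hH ⟨hopt, hacc⟩
  refine ⟨alg.estimate H, Finset.mem_univ _, playsList_identList hH.1 (hend _), ?_⟩
  rw [neg_neg, Real.exp_log (by exact_mod_cast hn), ENNReal.rpow_one, ENNReal.ofReal_natCast]
  exact hacc fstar hfstar hopt

theorem pathLaw_real_likelihoodRatio_lt_le {f g : Instance D ν} (hf : f ∈ F) (hg : g ∈ F)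
    (hopt : optDecision R g ≠ optDecision R f) (hn : 1 ≤ n) (hN : 1 ≤ programBound n)
    (hend : alg.testEnd ⟨f, hf⟩ ≤ n) (hfeas : ∃ w, IsFeasible R F f (programBound n) w)
    {lam : ℝ} (hlam : 0 < lam)
    (hrate : ∀ π, ratioMoment lam f g π ≤ ENNReal.ofReal (Real.exp (-(lam *
      truncKL f g (1 / (4 * Fintype.card D * programBound n ^ 2)) (2 * programBound n) π)))) :
    (pathLaw f alg.toPolicy n).real {H | (alg.estimate H : Instance D ν) = f ∧
        likelihoodRatio f g H alg.initList.length (alg.testEnd (alg.estimate H)) < n} ≤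
      Real.exp (-(lam * Real.log n * (1 / (2 * programBound n)))) := by
  have n_pos : (0 : ℝ) < n := by exact_mod_cast hn
  have exp_eq : ENNReal.ofReal (Real.exp (-(lam * Real.log n))) = ((n : ℝ≥0∞)⁻¹) ^ lam := by
    rw [← ENNReal.ofReal_natCast, ← ENNReal.ofReal_inv_of_pos n_pos,
      ENNReal.ofReal_rpow_of_pos (inv_pos.2 n_pos), Real.rpow_def_of_pos (inv_pos.2 n_pos),
      Real.log_inv, neg_mul, mul_comm lam]
  calc
    _ ≤ (pathLaw f alg.toPolicy n).real {H |
          PlaysList H alg.initList.length (alg.identList ⟨f, hf⟩) ∧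
            ENNReal.ofReal (Real.exp (-(lam * Real.log n))) ≤ likelihoodRatio g f H
              alg.initList.length (alg.testEnd ⟨f, hf⟩) ^ lam} := by
      refine measureReal_le_of_ae_imp ?_
      filter_upwards [ae_pathLaw_followsPolicy_and_density_ne_zero f alg.toPolicy n]
        with H hH ⟨hest, hlt⟩
      have est_eq : alg.estimate H = ⟨f, hf⟩ := Subtype.ext hest
      rw [est_eq] at hlt
      refine ⟨est_eq ▸ playsList_identList hH.1 (est_eq ▸ hend), ?_⟩
      rw [exp_eq, likelihoodRatio_swap fun i hi => hH.2 i (hi.trans_le hend)]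
      gcongr
    _ ≤ _ := by
      refine (pathLaw_real_le_likelihoodRatio_rpow_le f g alg.toPolicy hlam.le hrate hend
        (lam * Real.log n)).trans (Real.exp_le_exp.2 ?_)
      have log_le := mul_le_mul_of_nonneg_left
        (alg.one_add_mul_log_le_sum_count_mul_truncKL hf hg hopt hN hfeas) hlam.le
      simp only [mul_left_comm _ lam, ← Finset.mul_sum]
      linarith

theorem pathLaw_real_falseRejection_le (hn : 1 ≤ n) (hN : 1 ≤ programBound n)
    (hend : ∀ f, alg.testEnd f ≤ n)
    (hfeas : ∀ f ∈ F, ∃ w, IsFeasible R F f (programBound n) w) {lam : ℝ} (hlam : 0 < lam)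
    (hrate : ∀ f ∈ F, ∀ g ∈ F, ∀ π, ratioMoment lam f g π ≤ ENNReal.ofReal (Real.exp (-(lam *
      truncKL f g (1 / (4 * Fintype.card D * programBound n ^ 2)) (2 * programBound n) π)))) :
    (pathLaw fstar alg.toPolicy n).real (alg.falseRejection fstar) ≤
      (F ×ˢ F).card * Real.exp (-(lam * Real.log n * (1 / (2 * programBound n)))) := by
  refine (measureReal_mono (s₂ := {H | ∃ p ∈ F ×ˢ F, (fstar.law = p.1.law ∧
    optDecision R p.2 ≠ optDecision R p.1) ∧ (alg.estimate H : Instance D ν) = p.1 ∧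
      likelihoodRatio p.1 p.2 H alg.initList.length (alg.testEnd (alg.estimate H)) < n})
      ?_).trans (measureReal_exists_le_card_mul _ fun p hp => ?_)
  · rintro H ⟨hlaw, hacc⟩
    simp only [EstimateAccepted, not_forall, not_le] at hacc
    obtain ⟨g, hg, hopt, hlt⟩ := hacc
    exact ⟨(alg.estimate H, g), Finset.mk_mem_product (alg.estimate H).2 hg, ⟨hlaw, hopt⟩, rfl,
      hlt⟩
  obtain ⟨hf, hg⟩ := Finset.mem_product.1 hp
  by_cases h : fstar.law = p.1.law ∧ optDecision R p.2 ≠ optDecision R p.1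
  · simp only [h, ne_eq, not_false_eq_true, and_self, true_and]
    rw [pathLaw_congr h.1]
    exact alg.pathLaw_real_likelihoodRatio_lt_le hf hg h.2 hn hN (hend _) (hfeas _ hf) hlam
      (hrate _ hf _ hg)
  · simp [h, Real.exp_nonneg]

end TestToCommit

/-! ### UCB -/

section Plays

variable {D O : Type*} [DecidableEq D]

/-- The rounds `s ≤ i < t` in which `π` is played. -/
def plays (H : ℕ → D × O) (s t : ℕ) (π : D) : Finset ℕ :=
  (Finset.Ico s t).filter fun i => (H i).1 = π

theorem sum_fin_filter_eq_sum_plays {M : Type*} [AddCommMonoid M] (x : ℕ → M) (H : ℕ → D × O)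
    (s t : ℕ) (π : D) :
    ∑ i ∈ Finset.univ.filter (fun i : Fin t => s ≤ (i : ℕ) ∧ (H i).1 = π), x i =
      ∑ i ∈ plays H s t π, x i := by
  rw [Finset.sum_filter,
    Fin.sum_univ_eq_sum_range (fun i => if s ≤ i ∧ (H i).1 = π then x i else 0) t,
    ← Finset.sum_filter]
  congr 1
  ext i
  simp only [plays, Finset.mem_filter, Finset.mem_range, Finset.mem_Ico]
  tauto

theorem playCount_past (H : ℕ → D × O) (s t : ℕ) (π : D) :
    playCount (past H t) s π = (plays H s t π).card := by
  rw [playCount, Finset.card_eq_sum_ones, Finset.card_eq_sum_ones]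
  exact sum_fin_filter_eq_sum_plays (fun _ => 1) H s t π

theorem empiricalMean_past (R : O → ℝ) (H : ℕ → D × O) (s t : ℕ) (π : D) :
    empiricalMean R (past H t) s π =
      (∑ i ∈ plays H s t π, R (H i).2) / (plays H s t π).card := by
  rw [empiricalMean, playCount_past]
  congr 1
  exact sum_fin_filter_eq_sum_plays (fun i => R (H i).2) H s t π

theorem card_plays_succ (H : ℕ → D × O) {s t : ℕ} (h : s ≤ t) (π : D) :
    (plays H s (t + 1) π).card = (plays H s t π).card + if (H t).1 = π then 1 else 0 := by
  simp only [plays, Finset.card_filter]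
  rw [Finset.sum_Ico_succ_top h]

theorem card_plays_le_sub (H : ℕ → D × O) (s t : ℕ) (π : D) : (plays H s t π).card ≤ t - s :=
  (Finset.card_filter_le _ _).trans_eq (Nat.card_Ico s t)

theorem sum_Ico_eq_sum_card_plays [Fintype D] (H : ℕ → D × O) (s t : ℕ) (x : D → ℝ) :
    ∑ i ∈ Finset.Ico s t, x (H i).1 = ∑ π, ((plays H s t π).card : ℝ) * x π := by
  rw [← Finset.sum_fiberwise (Finset.Ico s t) (fun i => (H i).1)]
  refine Finset.sum_congr rfl fun π _ => ?_
  rw [← nsmul_eq_mul]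
  exact Finset.sum_eq_card_nsmul fun i hi => by rw [(Finset.mem_filter.1 hi).2]

end Plays

section UCB

variable {D O : Type*} [MeasurableSpace O] {ν : Measure O} {R : O → ℝ} {Rmax : ℝ}
  {f : Instance D ν} {n : ℕ}

/-- The width of the confidence interval that UCB uses after `k` plays. -/
def radius (Rmax : ℝ) (n k : ℕ) : ℝ :=
  Rmax * Real.sqrt (2 * Real.log ((n : ℝ) ^ 2) / k)

theorem radius_nonneg (hRmax : 0 ≤ Rmax) (n k : ℕ) : 0 ≤ radius Rmax n k :=
  mul_nonneg hRmax (Real.sqrt_nonneg _)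

theorem radius_sq (Rmax : ℝ) (n k : ℕ) :
    radius Rmax n k ^ 2 = 4 * Rmax ^ 2 * Real.log n / k := by
  have := Real.log_natCast_nonneg n
  rw [radius, mul_pow, Real.log_pow, Real.sq_sqrt (by positivity)]
  push_cast
  ring

theorem lintegral_exp_reward_le_one (hR : Measurable R) {π : D}
    (hbdd : ∀ᵐ o ∂(f.law π), 0 ≤ R o ∧ R o ≤ Rmax) (θ : ℝ) :
    ∫⁻ o, ENNReal.ofReal (Real.exp (θ * (R o - meanReward R f π) - θ ^ 2 * Rmax ^ 2 / 8))
      ∂(f.law π) ≤ 1 := by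
  have subgaussian := hasSubgaussianMGF_of_mem_Icc (μ := f.law π) (X := R) (a := 0) (b := Rmax)
    hR.aemeasurable hbdd
  have mgf_le := subgaussian.mgf_le θ
  simp only [mgf] at mgf_le
  simp only [sub_eq_add_neg _ (θ ^ 2 * Rmax ^ 2 / 8), Real.exp_add, meanReward]
  rw [← ofReal_integral_eq_lintegral_ofReal ((subgaussian.integrable_exp_mul θ).mul_const _)
    (ae_of_all _ fun o => by positivity), integral_mul_const]
  refine (ENNReal.ofReal_le_ofReal
    (mul_le_mul_of_nonneg_right mgf_le (Real.exp_pos _).le)).trans ?_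
  rw [← Real.exp_add, ENNReal.ofReal_le_one, Real.exp_le_one_iff]
  push_cast
  rw [sub_zero, Real.norm_eq_abs, div_pow, sq_abs]
  linarith

variable [DecidableEq D]

/-- The empirical means of all decisions over all intervals of rounds are within the confidence
radius of the means. The starting round is arbitrary since that of UCB is random. -/
def MeansConcentrated (R : O → ℝ) (Rmax : ℝ) (f : Instance D ν) (n : ℕ) (H : ℕ → D × O) : Prop :=
  ∀ s ≤ n, ∀ t ≤ n, ∀ π, (plays H s t π).card ≠ 0 →
    |empiricalMean R (past H t) s π - meanReward R f π| < radius Rmax n (plays H s t π).card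

/-- The parameter `θ = 4 * σ * radius / Rmax ^ 2` optimizes Chernoff's bound. -/
theorem eight_mul_log_le_sum_plays (hRmax : 0 < Rmax) {H : ℕ → D × O} {s t k : ℕ} {π : D}
    (hk : k ≠ 0) (hcard : (plays H s t π).card = k) {σ : ℝ} (hσ : σ ^ 2 = 1)
    (hdev : radius Rmax n k ≤ σ * (empiricalMean R (past H t) s π - meanReward R f π)) :
    8 * Real.log n ≤ ∑ i ∈ plays H s t π,
      (σ * (4 * radius Rmax n k / Rmax ^ 2) * (R (H i).2 - meanReward R f π) -
        (σ * (4 * radius Rmax n k / Rmax ^ 2)) ^ 2 * Rmax ^ 2 / 8) := by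
  have k_pos : (0 : ℝ) < k := by exact_mod_cast Nat.pos_of_ne_zero hk
  have radius_sq_mul : radius Rmax n k ^ 2 * k = 4 * Rmax ^ 2 * Real.log n := by
    rw [radius_sq]
    field_simp
  rw [empiricalMean_past, hcard] at hdev
  rw [Finset.sum_sub_distrib, ← Finset.mul_sum, Finset.sum_sub_distrib, Finset.sum_const,
    Finset.sum_const, hcard, nsmul_eq_mul, nsmul_eq_mul]
  set ρ := radius Rmax n k
  set S := ∑ i ∈ plays H s t π, R (H i).2
  have ρ_nonneg : 0 ≤ ρ := radius_nonneg hRmax.le n k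
  calc
    8 * Real.log n = 2 * (ρ ^ 2 * k) / Rmax ^ 2 := by
      rw [radius_sq_mul]
      field_simp
      ring
    _ = 4 * ρ * k / Rmax ^ 2 * ρ - k * (1 * (4 * ρ / Rmax ^ 2) ^ 2 * Rmax ^ 2 / 8) := by
      field_simp
      ring
    _ ≤ 4 * ρ * k / Rmax ^ 2 * (σ * (S / k - meanReward R f π)) -
          k * (1 * (4 * ρ / Rmax ^ 2) ^ 2 * Rmax ^ 2 / 8) := by
      gcongr
    _ = _ := by
      rw [mul_pow, hσ]
      field_simp

variable [MeasurableSpace D] [DiscreteMeasurableSpace D] [Nonempty (D × O)]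

theorem pathLaw_real_radius_le_deviation_le [Countable D] (hR : Measurable R) (hRmax : 0 < Rmax)
    (hbdd : ∀ π, ∀ᵐ o ∂(f.law π), 0 ≤ R o ∧ R o ≤ Rmax) (A : Policy D O) {s t k : ℕ}
    (ht : t ≤ n) (π : D) {σ : ℝ} (hσ : σ ^ 2 = 1) :
    (pathLaw f A n).real {H | k ≠ 0 ∧ (plays H s t π).card = k ∧
        radius Rmax n k ≤ σ * (empiricalMean R (past H t) s π - meanReward R f π)} ≤
      Real.exp (-(8 * Real.log n)) := by
  set θ : ℝ := σ * (4 * radius Rmax n k / Rmax ^ 2)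
  set factor : ℕ → D → O → ℝ≥0∞ := fun i d o => if (s ≤ i ∧ i < t) ∧ d = π then
    ENNReal.ofReal (Real.exp (θ * (R o - meanReward R f π) - θ ^ 2 * Rmax ^ 2 / 8)) else 1
  have factor_meas (i : ℕ) (d : D) : Measurable (factor i d) :=
    Measurable.ite (MeasurableSet.const _) (by fun_prop) measurable_const
  have factor_mean (i : ℕ) (d : D) : ∫⁻ o, factor i d o ∂(f.law d) ≤ 1 := by
    by_cases h : (s ≤ i ∧ i < t) ∧ d = π
    · simp only [factor, if_pos h]
      rw [h.2]
      exact lintegral_exp_reward_le_one hR (hbdd π) θ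
    · simp only [factor, if_neg h]
      simp
  have filter_eq (H : ℕ → D × O) :
      (Finset.range n).filter (fun i => (s ≤ i ∧ i < t) ∧ (H i).1 = π) = plays H s t π := by
    ext i
    simp only [plays, Finset.mem_filter, Finset.mem_range, Finset.mem_Ico]
    exact ⟨fun h => h.2, fun h => ⟨by omega, h⟩⟩
  refine (measureReal_mono ?_).trans
    (pathLaw_real_exp_le_prod_le f A factor_meas factor_mean n (8 * Real.log n))
  rintro H ⟨hk, hcard, hdev⟩
  rw [Set.mem_ofPred_eq, ← Finset.prod_filter, filter_eq,
    ← ENNReal.ofReal_prod_of_nonneg fun i _ => (Real.exp_pos _).le, ← Real.exp_sum]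
  gcongr
  exact eight_mul_log_le_sum_plays hRmax hk hcard hσ hdev

theorem pathLaw_real_not_meansConcentrated_le [Fintype D] (hR : Measurable R) (hRmax : 0 < Rmax)
    (hbdd : ∀ π, ∀ᵐ o ∂(f.law π), 0 ≤ R o ∧ R o ≤ Rmax) (A : Policy D O) :
    (pathLaw f A n).real {H | ¬ MeansConcentrated R Rmax f n H} ≤
      2 * Fintype.card D * (n + 1) ^ 3 * Real.exp (-(8 * Real.log n)) := by
  set signs : Finset ℝ := {1, -1}
  set rounds := Finset.range (n + 1)
  set indices := signs ×ˢ (Finset.univ : Finset D) ×ˢ rounds ×ˢ rounds ×ˢ rounds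
  have card_indices : (indices.card : ℝ) = 2 * Fintype.card D * (n + 1) ^ 3 := by
    have card_signs : signs.card = 2 := Finset.card_pair (by norm_num)
    simp only [indices, rounds, Finset.card_product, card_signs, Finset.card_univ,
      Finset.card_range]
    push_cast
    ring
  set deviates : ℝ × D × ℕ × ℕ × ℕ → (ℕ → D × O) → Prop := fun ⟨σ, π, s, t, k⟩ H =>
    k ≠ 0 ∧ (plays H s t π).card = k ∧
      radius Rmax n k ≤ σ * (empiricalMean R (past H t) s π - meanReward R f π)
  have deviates_le : ∀ i ∈ indices,
      (pathLaw f A n).real {H | deviates i H} ≤ Real.exp (-(8 * Real.log n)) := by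
    rintro ⟨σ, π, s, t, k⟩ hi
    simp only [indices, signs, rounds, Finset.mem_product, Finset.mem_insert,
      Finset.mem_singleton, Finset.mem_range, Nat.lt_succ_iff] at hi
    exact pathLaw_real_radius_le_deviation_le hR hRmax hbdd A hi.2.2.2.1 π
      (by rcases hi.1 with rfl | rfl <;> norm_num)
  rw [← card_indices]
  refine (measureReal_mono fun H hH => ?_).trans
    (measureReal_exists_le_card_mul indices deviates_le)
  simp only [MeansConcentrated, Set.mem_ofPred_eq, not_forall, not_lt] at hH
  obtain ⟨s, hs, t, ht, π, hk, hdev⟩ := hH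
  have card_le : (plays H s t π).card ≤ n :=
    (card_plays_le_sub H s t π).trans ((Nat.sub_le t s).trans ht)
  have mem_indices {σ : ℝ} (hσ : σ ∈ signs) : (σ, π, s, t, (plays H s t π).card) ∈ indices := by
    simpa only [indices, rounds, Finset.mem_product, Finset.mem_univ, Finset.mem_range,
      Nat.lt_succ_iff, true_and] using ⟨hσ, hs, ht, card_le⟩
  rcases le_abs.1 hdev with h | h
  · exact ⟨_, mem_indices (σ := 1) (by simp [signs]), hk, rfl, by simpa using h⟩
  · exact ⟨_, mem_indices (σ := -1) (by simp [signs]), hk, rfl, by simpa using h⟩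

end UCB

section UCBPhase

variable {D O : Type*} [MeasurableSpace O] {ν : Measure O} [DecidableEq D] [Nonempty D]
  {R : O → ℝ} {Rmax : ℝ} {f : Instance D ν} {n s : ℕ} {H : ℕ → D × O}

/-- In the rounds `s ≤ t < n` of `H` the decisions are those of UCB started in round `s`. -/
def FollowsUCB (R : O → ℝ) (Rmax : ℝ) (n s : ℕ) (H : ℕ → D × O) : Prop :=
  ∀ t, s ≤ t → t < n → ∀ π,
    ucbIndex R Rmax n (past H t) s π ≤ ucbIndex R Rmax n (past H t) s (H t).1

theorem gap_le_two_mul_radius [Finite D] (hconf : MeansConcentrated R Rmax f n H)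
    (hucb : FollowsUCB R Rmax n s H) {t : ℕ} (hst : s ≤ t) (htn : t < n)
    (hcard : (plays H s t (H t).1).card ≠ 0) :
    gap R f (H t).1 ≤ 2 * radius Rmax n (plays H s t (H t).1).card := by
  have index_le := hucb t hst htn (optDecision R f)
  rw [ucbIndex, ucbIndex, playCount_past, playCount_past, if_neg hcard] at index_le
  split_ifs at index_le with hopt
  · exact absurd (top_le_iff.1 index_le) (EReal.coe_ne_top _)
  rw [EReal.coe_le_coe_iff] at index_le
  change _ + radius Rmax n _ ≤ _ + radius Rmax n _ at index_le
  have opt_lower := (abs_lt.1 (hconf s (hst.trans htn.le) t htn.le _ hopt)).1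
  have played_upper := (abs_lt.1 (hconf s (hst.trans htn.le) t htn.le _ hcard)).2
  rw [gap]
  linarith

theorem card_plays_le [Finite D] (hconf : MeansConcentrated R Rmax f n H)
    (hucb : FollowsUCB R Rmax n s H) {π : D} (hgap : 0 < gap R f π) {t : ℕ} (hst : s ≤ t)
    (htn : t ≤ n) :
    ((plays H s t π).card : ℝ) ≤ 16 * Rmax ^ 2 * Real.log n / gap R f π ^ 2 + 1 := by
  have := Real.log_natCast_nonneg n
  induction t, hst using Nat.le_induction with
  | base =>
    simp only [plays, Finset.Ico_self, Finset.filter_empty, Finset.card_empty, Nat.cast_zero]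
    positivity
  | succ t hst ih =>
    rw [card_plays_succ H hst]
    split_ifs with hπ
    swap
    · simpa using ih (by omega)
    push_cast
    gcongr
    subst hπ
    rcases eq_or_ne (plays H s t (H t).1).card 0 with hcard | hcard
    · rw [hcard, Nat.cast_zero]
      positivity
    have sq_le := pow_le_pow_left₀ hgap.le (gap_le_two_mul_radius hconf hucb hst htn hcard) 2
    rw [mul_pow, radius_sq, ← mul_div_assoc,
      le_div_iff₀ (by exact_mod_cast Nat.pos_of_ne_zero hcard)] at sq_le
    rw [le_div_iff₀ (by positivity)]
    linarith

theorem sum_gap_le_of_followsUCB [Fintype D] (hle : ∀ π, gap R f π ≤ Rmax) (hs : s ≤ n)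
    (hconf : MeansConcentrated R Rmax f n H) (hucb : FollowsUCB R Rmax n s H) :
    ∑ i ∈ Finset.Ico s n, gap R f (H i).1 ≤
      (∑ π, 16 * Rmax ^ 2 / gap R f π) * Real.log n + Fintype.card D * Rmax := by
  rw [sum_Ico_eq_sum_card_plays H s n (gap R f), Finset.sum_mul, ← nsmul_eq_mul,
    ← Finset.card_univ, ← Finset.sum_const, ← Finset.sum_add_distrib]
  refine Finset.sum_le_sum fun π _ => ?_
  rcases (gap_nonneg R f π).eq_or_lt with gap_zero | gap_pos
  · rw [← gap_zero]
    simpa [← gap_zero] using hle π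
  calc
    _ ≤ (16 * Rmax ^ 2 * Real.log n / gap R f π ^ 2 + 1) * gap R f π := by
      gcongr
      exact card_plays_le hconf hucb gap_pos hs le_rfl
    _ = 16 * Rmax ^ 2 / gap R f π * Real.log n + gap R f π := by field_simp
    _ ≤ _ := by gcongr; exact hle π

end UCBPhase

/-! ### The regret of Test-to-Commit -/

section RegretBounds

variable {D O : Type*} [MeasurableSpace O] {ν : Measure O} [Fintype D]

/-- A bound on the number of rounds of the identification step. -/
def identLength (D : Type*) [Fintype D] (n : ℕ) : ℝ :=
  Fintype.card D *
    (((1 + 1 / programBound n) * programBound n + 1 / programBound n) * Real.log n + 1)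

theorem identLength_nonneg (D : Type*) [Fintype D] {n : ℕ} (hN : 0 ≤ programBound n) :
    0 ≤ identLength D n := by
  have := Real.log_natCast_nonneg n
  rw [identLength]
  positivity

variable [Nonempty D] {R : O → ℝ} {Rmax : ℝ} {f : Instance D ν}

/-- A bound on the regret of UCB when all empirical means are concentrated. The optimal decisions
contribute `0` to the sum, by the convention `x / 0 = 0`. -/
def ucbBound (R : O → ℝ) (Rmax : ℝ) (f : Instance D ν) (n : ℕ) : ℝ :=
  (∑ π, 16 * Rmax ^ 2 / gap R f π) * Real.log n + Fintype.card D * Rmax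

theorem ucbBound_nonneg (R : O → ℝ) (hRmax : 0 ≤ Rmax) (f : Instance D ν) (n : ℕ) :
    0 ≤ ucbBound R Rmax f n := by
  have := Real.log_natCast_nonneg n
  have sum_nonneg : 0 ≤ ∑ π, 16 * Rmax ^ 2 / gap R f π :=
    Finset.sum_nonneg fun π _ => div_nonneg (by positivity) (gap_nonneg R f π)
  rw [ucbBound]
  positivity

/-- A bound on the regret of the identification step when the estimate has the laws of `f`. -/
def identRegret (R : O → ℝ) (Rmax : ℝ) (F : Finset (Instance D ν)) (f : Instance D ν) (n : ℕ)
    (η : ℝ≥0) : ℝ :=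
  ((1 + 1 / programBound n) * ((complexityAt R F f (programBound n)).toReal + η) +
    1 / programBound n * (Fintype.card D * Rmax)) * Real.log n + Fintype.card D * Rmax

theorem identRegret_nonneg (R : O → ℝ) (hRmax : 0 ≤ Rmax) (F : Finset (Instance D ν))
    (f : Instance D ν) {n : ℕ} (hN : 0 ≤ programBound n) (η : ℝ≥0) :
    0 ≤ identRegret R Rmax F f n η := by
  have := Real.log_natCast_nonneg n
  have value_nonneg := EReal.toReal_nonneg (complexityAt_nonneg R F f (programBound n))
  rw [identRegret]
  positivity

end RegretBounds

namespace TestToCommit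

variable {D O : Type*} [MeasurableSpace O] {ν : Measure O} [Fintype D] [DecidableEq D]
  [Nonempty D] [MeasurableSpace D] {R : O → ℝ} {Rmax : ℝ} {F : Finset (Instance D ν)} {n : ℕ}
  {η : ℝ≥0} (alg : TestToCommit R Rmax F n η)

theorem length_initList : alg.initList.length = Fintype.card D * initPlays n := by
  rw [← Multiset.coe_card, ← Multiset.sum_count_eq_card (s := Finset.univ) (by simp)]
  simp [alg.count_initList, initPlays]

theorem count_identList_le (hN : 0 ≤ programBound n) (f : F) (π : D) :
    ((alg.identList f).count π : ℝ) ≤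
      mixedWeight (programBound n) (alg.weight f) π * Real.log n + 1 := by
  rw [alg.count_identList]
  exact (Nat.ceil_lt_add_one
    (mul_nonneg (mixedWeight_nonneg hN _ π) (Real.log_natCast_nonneg n))).le

theorem length_identList_le (hN : 0 ≤ programBound n) {f : F}
    (hfeas : ∃ w, IsFeasible R F f (programBound n) w) :
    ((alg.identList f).length : ℝ) ≤ identLength D n := by
  have := Real.log_natCast_nonneg n
  rw [← Multiset.coe_card, ← Multiset.sum_count_eq_card (s := Finset.univ) (by simp),
    Nat.cast_sum, identLength, ← nsmul_eq_mul, ← Finset.card_univ, ← Finset.sum_const]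
  refine Finset.sum_le_sum fun π _ => ?_
  rw [Multiset.coe_count]
  refine (alg.count_identList_le hN f π).trans ?_
  rw [mixedWeight]
  gcongr
  exact (alg.isSolution_weight f hfeas).1.2 π

theorem sum_count_identList_mul_gap_le (hN : 0 ≤ programBound n) {fstar : Instance D ν}
    (hle : ∀ π, gap R fstar π ≤ Rmax) {f : F} (hlaw : fstar.law = (f : Instance D ν).law)
    (hfeas : ∃ w, IsFeasible R F f (programBound n) w) :
    ∑ π, ((alg.identList f).count π : ℝ) * gap R fstar π ≤ identRegret R Rmax F fstar n η := by
  have := Real.log_natCast_nonneg n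
  have cost_le : cost R fstar (alg.weight f) ≤
      (complexityAt R F fstar (programBound n)).toReal + η := by
    refine cost_le_of_isSolution ?_
    rw [isSolution_congr R F hlaw]
    exact alg.isSolution_weight f hfeas
  have sum_le : ∑ π, gap R fstar π ≤ Fintype.card D * Rmax :=
    sum_gap_le_card_mul hle Finset.univ id
  calc
    _ ≤ ∑ π, (mixedWeight (programBound n) (alg.weight f) π * Real.log n + 1) * gap R fstar π :=
      Finset.sum_le_sum fun π _ =>
        mul_le_mul_of_nonneg_right (alg.count_identList_le hN f π) (gap_nonneg R fstar π)
    _ = ((1 + 1 / programBound n) * cost R fstar (alg.weight f) +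
          1 / programBound n * ∑ π, gap R fstar π) * Real.log n + ∑ π, gap R fstar π := by
      rw [cost, Finset.mul_sum, Finset.mul_sum, ← Finset.sum_add_distrib, Finset.sum_mul,
        ← Finset.sum_add_distrib]
      refine Finset.sum_congr rfl fun π _ => ?_
      rw [mixedWeight]
      ring
    _ ≤ _ := by
      rw [identRegret]
      gcongr

section Path

variable {alg} {fstar : Instance D ν} {H : ℕ → D × O}

theorem sum_gap_identification_le (hN : 0 ≤ programBound n) (hle : ∀ π, gap R fstar π ≤ Rmax)
    (hfeas : ∀ f ∈ F, ∃ w, IsFeasible R F f (programBound n) w)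
    (hH : FollowsPolicy alg.toPolicy n H) (hend : alg.testEnd (alg.estimate H) ≤ n) :
    ∑ i ∈ Finset.Ico alg.initList.length (alg.testEnd (alg.estimate H)), gap R fstar (H i).1 ≤
      identRegret R Rmax F fstar n η +
        (alg.misestimation fstar).indicator (fun _ => identLength D n * Rmax) H := by
  have Rmax_nonneg := nonneg_of_gap_le hle
  have feasible := hfeas _ (alg.estimate H).2
  by_cases hlaw : fstar.law = (alg.estimate H : Instance D ν).law
  · rw [Set.indicator_of_notMem (not_not.2 hlaw), add_zero, testEnd,
      (playsList_identList hH hend).sum_Ico_eq_sum_count]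
    exact alg.sum_count_identList_mul_gap_le hN hle hlaw feasible
  · rw [Set.indicator_of_mem hlaw]
    refine (sum_gap_le_card_mul hle _ fun i => (H i).1).trans ?_
    rw [Nat.card_Ico, testEnd, Nat.add_sub_cancel_left]
    have length_le := mul_le_mul_of_nonneg_right (alg.length_identList_le hN feasible) Rmax_nonneg
    linarith [identRegret_nonneg R Rmax_nonneg F fstar hN η]

theorem sum_gap_eq_zero_of_estimateAccepted (hn : 0 < n) (hH : FollowsPolicy alg.toPolicy n H)
    (hacc : alg.EstimateAccepted H)
    (hopt : optDecision R fstar = optDecision R (alg.estimate H : Instance D ν)) :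
    ∑ i ∈ Finset.Ico (alg.testEnd (alg.estimate H)) n, gap R fstar (H i).1 = 0 := by
  refine Finset.sum_eq_zero fun t ht => ?_
  obtain ⟨hend, htn⟩ := Finset.mem_Ico.1 ht
  rw [hH t htn, alg.act_commit t ((Nat.le_add_right _ _).trans hend) _ (alg.estimate H) rfl hend
    ((alg.accepts_past_iff hn hend).2 hacc), ← hopt, gap_optDecision]

theorem followsUCB_of_not_estimateAccepted (hn : 0 < n) (hH : FollowsPolicy alg.toPolicy n H)
    (hacc : ¬ alg.EstimateAccepted H) :
    FollowsUCB R Rmax n (alg.testEnd (alg.estimate H)) H := by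
  intro t hend htn π
  rw [hH t htn]
  exact alg.act_ucb t ((Nat.le_add_right _ _).trans hend) _ (alg.estimate H) rfl hend
    (fun h => hacc ((alg.accepts_past_iff hn hend).1 h)) π

theorem sum_gap_exploitation_le (hn : 0 < n) (hle : ∀ π, gap R fstar π ≤ Rmax)
    (hH : FollowsPolicy alg.toPolicy n H) (hend : alg.testEnd (alg.estimate H) ≤ n) :
    ∑ i ∈ Finset.Ico (alg.testEnd (alg.estimate H)) n, gap R fstar (H i).1 ≤
      (alg.misestimation fstar).indicator (fun _ => ucbBound R Rmax fstar n) H +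
        (alg.falseAcceptance fstar).indicator (fun _ => n * Rmax) H +
        (alg.falseRejection fstar).indicator (fun _ => ucbBound R Rmax fstar n) H +
        {H | ¬ MeansConcentrated R Rmax fstar n H}.indicator (fun _ => n * Rmax) H := by
  have Rmax_nonneg := nonneg_of_gap_le hle
  have ucb_nonneg := ucbBound_nonneg R Rmax_nonneg fstar n
  have indicator_nonneg {E : Set (ℕ → D × O)} {c : ℝ} (hc : 0 ≤ c) :
      0 ≤ E.indicator (fun _ => c) H := Set.indicator_nonneg (fun _ _ => hc) H
  have crude : ∑ i ∈ Finset.Ico (alg.testEnd (alg.estimate H)) n, gap R fstar (H i).1 ≤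
      n * Rmax := by
    refine (sum_gap_le_card_mul hle _ fun i => (H i).1).trans ?_
    rw [Nat.card_Ico]
    gcongr
    exact Nat.sub_le _ _
  have horizon_nonneg : 0 ≤ n * Rmax := by positivity
  have E₀_nonneg := indicator_nonneg (E := alg.misestimation fstar) ucb_nonneg
  have E₁_nonneg := indicator_nonneg (E := alg.falseAcceptance fstar) horizon_nonneg
  have E₂_nonneg := indicator_nonneg (E := alg.falseRejection fstar) ucb_nonneg
  have E₃_nonneg := indicator_nonneg (E := {H | ¬ MeansConcentrated R Rmax fstar n H})
    horizon_nonneg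
  by_cases hacc : alg.EstimateAccepted H
  · by_cases hopt : optDecision R fstar = optDecision R (alg.estimate H : Instance D ν)
    · rw [sum_gap_eq_zero_of_estimateAccepted hn hH hacc hopt]
      linarith
    · rw [Set.indicator_of_mem (s := alg.falseAcceptance fstar) ⟨hopt, hacc⟩]
      linarith
  by_cases hconf : MeansConcentrated R Rmax fstar n H
  · have ucb_le : _ ≤ ucbBound R Rmax fstar n :=
      sum_gap_le_of_followsUCB hle hend hconf (followsUCB_of_not_estimateAccepted hn hH hacc)
    by_cases hlaw : fstar.law = (alg.estimate H : Instance D ν).law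
    · rw [Set.indicator_of_mem (s := alg.falseRejection fstar) ⟨hlaw, hacc⟩]
      linarith
    · rw [Set.indicator_of_mem (s := alg.misestimation fstar) hlaw]
      linarith
  · rw [Set.indicator_of_mem (s := {H | ¬ MeansConcentrated R Rmax fstar n H}) hconf]
    linarith

theorem sum_gap_le (hn : 0 < n) (hN : 0 ≤ programBound n) (hle : ∀ π, gap R fstar π ≤ Rmax)
    (hfeas : ∀ f ∈ F, ∃ w, IsFeasible R F f (programBound n) w)
    (hH : FollowsPolicy alg.toPolicy n H) (hend : alg.testEnd (alg.estimate H) ≤ n) :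
    ∑ i ∈ Finset.range n, gap R fstar (H i).1 ≤
      Fintype.card D * initPlays n * Rmax + identRegret R Rmax F fstar n η +
        ((alg.misestimation fstar).indicator
            (fun _ => identLength D n * Rmax + ucbBound R Rmax fstar n) H +
          (alg.falseAcceptance fstar).indicator (fun _ => n * Rmax) H +
          (alg.falseRejection fstar).indicator (fun _ => ucbBound R Rmax fstar n) H +
          {H | ¬ MeansConcentrated R Rmax fstar n H}.indicator (fun _ => n * Rmax) H) := by
  have initialization_le : ∑ i ∈ Finset.Ico 0 alg.initList.length, gap R fstar (H i).1 ≤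
      Fintype.card D * initPlays n * Rmax := by
    refine (sum_gap_le_card_mul hle _ fun i => (H i).1).trans_eq ?_
    rw [Nat.card_Ico, Nat.sub_zero, alg.length_initList, Nat.cast_mul]
  have identification_le := sum_gap_identification_le hN hle hfeas hH hend
  have exploitation_le := sum_gap_exploitation_le hn hle hH hend
  rw [Finset.range_eq_Ico, ← Finset.sum_Ico_consecutive _ (Nat.zero_le _) hend,
    ← Finset.sum_Ico_consecutive _ (Nat.zero_le alg.initList.length)
      (show alg.initList.length ≤ alg.testEnd (alg.estimate H) from Nat.le_add_right _ _),
    Set.indicator_add]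
  linarith

end Path

end TestToCommit

/-- A bound on the regret of Test-to-Commit, where `exp (-c)` bounds the Hellinger affinities of
distinct laws and `lam` is the order of the moments that control the identification step. The last
four terms belong to the events `misestimation`, `falseAcceptance`, `falseRejection` and the
failure of `MeansConcentrated`. -/
def regretBound {D O : Type*} [MeasurableSpace O] {ν : Measure O} [Fintype D] [Nonempty D]
    (R : O → ℝ) (Rmax : ℝ) (F : Finset (Instance D ν)) (f : Instance D ν) (n : ℕ) (η : ℝ≥0)
    (c lam : ℝ) : ℝ :=
  Fintype.card D * initPlays n * Rmax + identRegret R Rmax F f n η +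
    ((identLength D n * Rmax + ucbBound R Rmax f n) * (F.card * Real.exp (-(c * initPlays n))) +
      n * Rmax * (F.card * (1 / n)) +
      ucbBound R Rmax f n *
        ((F ×ˢ F).card * Real.exp (-(lam * Real.log n * (1 / (2 * programBound n))))) +
      n * Rmax * (2 * Fintype.card D * (n + 1) ^ 3 * Real.exp (-(8 * Real.log n))))

theorem TestToCommit.regret_le {D O : Type*} [MeasurableSpace O] {ν : Measure O} [Fintype D]
    [DecidableEq D] [Nonempty D] [MeasurableSpace D] [DiscreteMeasurableSpace D]
    [Nonempty (D × O)] {R : O → ℝ} {Rmax : ℝ} {F : Finset (Instance D ν)} {n : ℕ} {η : ℝ≥0}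
    (alg : TestToCommit R Rmax F n η) (hn : 0 < n) (hN : 1 ≤ programBound n)
    (hfeas : ∀ f ∈ F, ∃ w, IsFeasible R F f (programBound n) w) (hend : ∀ f, alg.testEnd f ≤ n)
    (hR : Measurable R) (hRmax : 0 < Rmax) {fstar : Instance D ν} (hfstar : fstar ∈ F)
    (hbdd : ∀ π, ∀ᵐ o ∂(fstar.law π), 0 ≤ R o ∧ R o ≤ Rmax) {c lam : ℝ} (hc : 0 ≤ c)
    (hsep : ∀ g ∈ F, ∀ π, fstar.law π ≠ g.law π →
      ratioMoment (1 / 2) fstar g π ≤ ENNReal.ofReal (Real.exp (-c))) (hlam : 0 < lam)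
    (hrate : ∀ f ∈ F, ∀ g ∈ F, ∀ π, ratioMoment lam f g π ≤ ENNReal.ofReal (Real.exp (-(lam *
      truncKL f g (1 / (4 * Fintype.card D * programBound n ^ 2)) (2 * programBound n) π)))) :
    regret R fstar alg.toPolicy n ≤ regretBound R Rmax F fstar n η c lam := by
  have hle := gap_le hR hbdd
  have hN₀ : 0 ≤ programBound n := zero_le_one.trans hN
  have ucb_nonneg := ucbBound_nonneg R hRmax.le fstar n
  have ident_nonneg : 0 ≤ identLength D n * Rmax + ucbBound R Rmax fstar n :=
    add_nonneg (mul_nonneg (identLength_nonneg D hN₀) hRmax.le) ucb_nonneg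
  have horizon_nonneg : 0 ≤ n * Rmax := by positivity
  rw [regret_eq_integral_pathLaw]
  calc
    _ ≤ Fintype.card D * initPlays n * Rmax + identRegret R Rmax F fstar n η +
          ∑ i, ![identLength D n * Rmax + ucbBound R Rmax fstar n, n * Rmax,
            ucbBound R Rmax fstar n, n * Rmax] i * (pathLaw fstar alg.toPolicy n).real
              (![alg.misestimation fstar, alg.falseAcceptance fstar, alg.falseRejection fstar,
                {H | ¬ MeansConcentrated R Rmax fstar n H}] i) := by
      refine integral_le_add_sum_mul_measureReal (integrable_sum_gap hle _ _) ?_ ?_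
      · rw [Fin.forall_fin_succ, Fin.forall_fin_succ, Fin.forall_fin_two]
        exact ⟨fun _ => ident_nonneg, fun _ => horizon_nonneg, fun _ => ucb_nonneg,
          fun _ => horizon_nonneg⟩
      · filter_upwards [ae_pathLaw_followsPolicy_and_density_ne_zero fstar alg.toPolicy n] with H hH
        rw [Fin.sum_univ_four]
        exact sum_gap_le hn hN₀ hle hfeas hH.1 (hend _)
    _ ≤ regretBound R Rmax F fstar n η c lam := by
      rw [Fin.sum_univ_four, regretBound]
      refine add_le_add_right (add_le_add (add_le_add (add_le_add ?_ ?_) ?_) ?_) _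
      · exact mul_le_mul_of_nonneg_left (alg.pathLaw_real_misestimation_le hfstar
          ((Nat.le_add_right _ _).trans (hend ⟨fstar, hfstar⟩)) hc hsep)
            ident_nonneg
      · exact mul_le_mul_of_nonneg_left (alg.pathLaw_real_falseAcceptance_le hfstar hn hend)
          horizon_nonneg
      · exact mul_le_mul_of_nonneg_left
          (alg.pathLaw_real_falseRejection_le hn hN hend hfeas hlam hrate) ucb_nonneg
      · exact mul_le_mul_of_nonneg_left
          (pathLaw_real_not_meansConcentrated_le hR hRmax hbdd alg.toPolicy) horizon_nonneg

/-! ### Asymptotics -/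

section Asymptotics

theorem tendsto_log_natCast : Tendsto (fun n : ℕ => Real.log n) atTop atTop :=
  Real.tendsto_log_atTop.comp tendsto_natCast_atTop_atTop

theorem tendsto_log_log_natCast : Tendsto (fun n : ℕ => Real.log (Real.log n)) atTop atTop :=
  Real.tendsto_log_atTop.comp tendsto_log_natCast

theorem tendsto_const_div_log_natCast (C : ℝ) :
    Tendsto (fun n : ℕ => C / Real.log n) atTop (𝓝 0) :=
  tendsto_log_natCast.const_div_atTop C

theorem tendsto_programBound : Tendsto programBound atTop atTop :=
  (tendsto_rpow_atTop (by norm_num)).comp tendsto_log_log_natCast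

theorem tendsto_one_div_programBound : Tendsto (fun n => 1 / programBound n) atTop (𝓝 0) :=
  tendsto_programBound.const_div_atTop 1

theorem eventually_programBound_le : ∀ᶠ n : ℕ in atTop,
    programBound n ≤ Real.log (Real.log n) := by
  filter_upwards [tendsto_log_log_natCast.eventually_ge_atTop 1] with n hn
  exact (Real.rpow_le_rpow_of_exponent_le hn (by norm_num)).trans_eq (Real.rpow_one _)

theorem eventually_mul_log_pow_le (C : ℝ) (k : ℕ) :
    ∀ᶠ x : ℝ in atTop, C * Real.log x ^ k ≤ x := by
  have isLittleO := (Real.isLittleO_pow_log_id_atTop (n := k)).bound (c := 1 / (|C| + 1))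
    (by positivity)
  filter_upwards [isLittleO, eventually_ge_atTop 1] with x hx one_le
  have pow_nonneg : 0 ≤ Real.log x ^ k := pow_nonneg (Real.log_nonneg one_le) k
  rw [Real.norm_of_nonneg pow_nonneg, id, Real.norm_of_nonneg (by linarith), one_div,
    inv_mul_eq_div, le_div_iff₀ (by positivity)] at hx
  nlinarith [le_abs_self C]

theorem eventually_initPlays_le : ∀ᶠ n : ℕ in atTop,
    (initPlays n : ℝ) ≤ Real.log n / Real.log (Real.log n) + 1 := by
  filter_upwards [tendsto_log_log_natCast.eventually_ge_atTop 0] with n hn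
  exact (Nat.ceil_lt_add_one (div_nonneg (Real.log_natCast_nonneg n) hn)).le

theorem tendsto_initPlays_div_log :
    Tendsto (fun n : ℕ => (initPlays n : ℝ) / Real.log n) atTop (𝓝 0) := by
  have upper_tendsto : Tendsto (fun n : ℕ => 1 / Real.log (Real.log n) + 1 / Real.log n) atTop
      (𝓝 0) := by
    simpa using (tendsto_log_log_natCast.const_div_atTop 1).add (tendsto_const_div_log_natCast 1)
  refine squeeze_zero' (Eventually.of_forall fun n =>
    div_nonneg (Nat.cast_nonneg _) (Real.log_natCast_nonneg n)) ?_ upper_tendsto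
  filter_upwards [tendsto_log_natCast.eventually_gt_atTop 0, eventually_initPlays_le] with n hn hle
  rw [div_le_iff₀ hn]
  refine hle.trans_eq ?_
  field_simp

/-- The initialization is just long enough: the error probability of the estimate beats the factor
`programBound n` by which the identification step exceeds `ln n`. -/
theorem tendsto_exp_neg_initPlays_mul_programBound {c : ℝ} (hc : 0 < c) :
    Tendsto (fun n : ℕ => Real.exp (-(c * initPlays n)) * programBound n) atTop (𝓝 0) := by
  have upper_tendsto : Tendsto (fun n : ℕ => Real.log (Real.log n) ^ (1 : ℝ) *
      Real.exp (-c * Real.log (Real.log n))) atTop (𝓝 0) :=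
    (tendsto_rpow_mul_exp_neg_mul_atTop_nhds_zero 1 c hc).comp tendsto_log_log_natCast
  refine squeeze_zero' ?_ ?_ upper_tendsto
  · filter_upwards [tendsto_programBound.eventually_ge_atTop 0] with n hn
    positivity
  · filter_upwards [tendsto_programBound.eventually_ge_atTop 0, eventually_programBound_le,
      tendsto_log_log_natCast.eventually_gt_atTop 0,
      tendsto_log_natCast.eventually (eventually_mul_log_pow_le 1 2)] with n hN hle hpos hsq
    have log_log_le : Real.log (Real.log n) ≤ initPlays n := by
      refine le_trans ?_ (Nat.le_ceil _)
      rw [le_div_iff₀ hpos, ← sq]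
      linarith
    rw [Real.rpow_one, mul_comm, neg_mul]
    gcongr

theorem tendsto_exp_neg_initPlays {c : ℝ} (hc : 0 < c) :
    Tendsto (fun n : ℕ => Real.exp (-(c * initPlays n))) atTop (𝓝 0) := by
  refine squeeze_zero' (Eventually.of_forall fun n => (Real.exp_pos _).le) ?_
    (tendsto_exp_neg_initPlays_mul_programBound hc)
  filter_upwards [tendsto_programBound.eventually_ge_atTop 1] with n hn
  exact le_mul_of_one_le_right (Real.exp_pos _).le hn

theorem tendsto_exp_neg_rpow_programBound {A : ℝ} (hA : 0 < A) (q : ℝ) :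
    Tendsto (fun n : ℕ => Real.exp (-(A * programBound n ^ (-q) * Real.log n *
      (1 / (2 * programBound n))))) atTop (𝓝 0) := by
  refine Real.tendsto_exp_atBot.comp (tendsto_neg_atTop_atBot.comp ?_)
  have ratio_tendsto : Tendsto (fun x : ℝ => Real.log x ^ ((q + 1) / 4) / x ^ (1 : ℝ)) atTop
      (𝓝[>] 0) := by
    refine tendsto_nhdsWithin_iff.2
      ⟨(isLittleO_log_rpow_rpow_atTop _ one_pos).tendsto_div_nhds_zero, ?_⟩
    filter_upwards [eventually_gt_atTop 1] with x hx
    exact div_pos (Real.rpow_pos_of_pos (Real.log_pos hx) _)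
      (Real.rpow_pos_of_pos (one_pos.trans hx) _)
  refine ((ratio_tendsto.inv_tendsto_nhdsGT_zero.comp tendsto_log_natCast).const_mul_atTop
    (half_pos hA)).congr' ?_
  filter_upwards [tendsto_log_log_natCast.eventually_gt_atTop 0,
    tendsto_programBound.eventually_gt_atTop 0] with n hpos hN
  have rpow_eq : Real.log (Real.log n) ^ ((q + 1) / 4) = programBound n ^ (q + 1) := by
    rw [programBound, ← Real.rpow_mul hpos.le]
    ring_nf
  simp only [Function.comp, Pi.inv_apply, Real.rpow_one, inv_div, rpow_eq]
  rw [Real.rpow_neg hN.le, Real.rpow_add hN, Real.rpow_one]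
  field_simp

theorem tendsto_mul_pow_mul_exp_neg_log_div_log (K : ℝ) :
    Tendsto (fun n : ℕ => n * K * ((n + 1) ^ 3 * Real.exp (-(8 * Real.log n))) / Real.log n) atTop
      (𝓝 0) := by
  refine squeeze_zero_norm' ?_ (tendsto_const_div_log_natCast (8 * |K|))
  filter_upwards [eventually_ge_atTop 1] with n hn
  have one_le : (1 : ℝ) ≤ n := by exact_mod_cast hn
  have exp_eq : Real.exp (-(8 * Real.log n)) = ((n : ℝ) ^ 8)⁻¹ := by
    rw [Real.exp_neg, ← Real.exp_log (by positivity : (0 : ℝ) < n ^ 8), Real.log_pow]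
    norm_cast
  rw [norm_div, Real.norm_of_nonneg (Real.log_natCast_nonneg n), exp_eq, norm_mul, norm_mul,
    Real.norm_natCast, Real.norm_eq_abs, Real.norm_of_nonneg (by positivity), mul_right_comm]
  refine div_le_div_of_nonneg_right (mul_le_mul_of_nonneg_right ?_ (abs_nonneg K))
    (Real.log_natCast_nonneg n)
  rw [← mul_assoc, ← div_eq_mul_inv, div_le_iff₀ (by positivity)]
  calc
    (n : ℝ) * (n + 1) ^ 3 ≤ n * (2 * n) ^ 3 := by
      gcongr
      linarith
    _ = 8 * (n : ℝ) ^ 4 := by ring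
    _ ≤ 8 * (n : ℝ) ^ 8 := by
      gcongr 8 * ?_
      exact pow_le_pow_right₀ one_le (by norm_num)

theorem tendsto_exp_neg_initPlays_mul_identLength_div_log (D : Type*) [Fintype D] {c : ℝ}
    (hc : 0 < c) :
    Tendsto (fun n : ℕ => Real.exp (-(c * initPlays n)) * (identLength D n / Real.log n)) atTop
      (𝓝 0) := by
  have expanded := ((tendsto_exp_neg_initPlays_mul_programBound hc).add
    ((tendsto_exp_neg_initPlays hc).mul ((tendsto_one_div_programBound.const_add 1).add
      (tendsto_const_div_log_natCast 1)))).const_mul (Fintype.card D : ℝ)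
  simp only [zero_mul, add_zero, mul_zero] at expanded
  refine expanded.congr' ?_
  filter_upwards [tendsto_log_natCast.eventually_gt_atTop 0,
    tendsto_programBound.eventually_gt_atTop 0] with n hlog hN
  rw [identLength]
  field_simp
  ring

theorem eventually_card_mul_initPlays_add_identLength_le (D : Type*) [Fintype D] :
    ∀ᶠ n : ℕ in atTop, Fintype.card D * (initPlays n : ℝ) + identLength D n ≤ n := by
  filter_upwards [tendsto_log_natCast.eventually_ge_atTop 1,
    tendsto_log_log_natCast.eventually_ge_atTop 1, tendsto_programBound.eventually_ge_atTop 1,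
    eventually_programBound_le, eventually_initPlays_le, tendsto_natCast_atTop_atTop.eventually
      (eventually_mul_log_pow_le (6 * Fintype.card D) 2)]
    with n hx hlog hN hNlog hinit hn
  set x := Real.log n
  set N := programBound n
  have N_le : N ≤ x := hNlog.trans (Real.log_le_self (by linarith))
  have init_le : (initPlays n : ℝ) ≤ x + 1 :=
    hinit.trans (by gcongr; exact div_le_self (by linarith) hlog)
  have weight_le : (1 + 1 / N) * N + 1 / N ≤ x + 2 := by
    have mul_eq : (1 + 1 / N) * N = N + 1 := by field_simp
    have inv_le : 1 / N ≤ 1 := (div_le_one (by linarith)).2 hN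
    linarith
  calc
    Fintype.card D * (initPlays n : ℝ) + identLength D n
        ≤ Fintype.card D * (x + 1) + Fintype.card D * ((x + 2) * x + 1) := by
      rw [identLength]
      gcongr
    _ = Fintype.card D * (x ^ 2 + 3 * x + 2) := by ring
    _ ≤ Fintype.card D * (6 * x ^ 2) := by
      gcongr
      nlinarith
    _ ≤ n := by linarith

end Asymptotics

section Limit

variable {D O : Type*} [MeasurableSpace O] {ν : Measure O} [Fintype D] [Nonempty D]

theorem tendsto_ucbBound_div_log (R : O → ℝ) (Rmax : ℝ) (f : Instance D ν) :
    Tendsto (fun n : ℕ => ucbBound R Rmax f n / Real.log n) atTop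
      (𝓝 (∑ π, 16 * Rmax ^ 2 / gap R f π)) := by
  have expanded := (tendsto_const_div_log_natCast (Fintype.card D * Rmax)).const_add
    (∑ π, 16 * Rmax ^ 2 / gap R f π)
  rw [add_zero] at expanded
  refine expanded.congr' ?_
  filter_upwards [tendsto_log_natCast.eventually_gt_atTop 0] with n hn
  rw [ucbBound, add_div, mul_div_cancel_right₀ _ hn.ne']

theorem tendsto_identRegret_div_log (R : O → ℝ) (Rmax : ℝ) {F : Finset (Instance D ν)}
    {f : Instance D ν} (hf : f ∈ F) {η : ℕ → ℝ≥0} (hη : Tendsto η atTop (𝓝 0)) :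
    Tendsto (fun n : ℕ => identRegret R Rmax F f n (η n) / Real.log n) atTop
      (𝓝 (complexity R F f).toReal) := by
  have value_tendsto : Tendsto (fun n : ℕ => (complexityAt R F f (programBound n)).toReal) atTop
      (𝓝 (complexity R F f).toReal) :=
    (EReal.tendsto_toReal (complexity_ne_top R hf) (complexity_ne_bot R F f)).comp
      ((tendsto_complexityAt R F f).comp tendsto_programBound)
  have expanded := (((tendsto_one_div_programBound.const_add 1).mul
    (value_tendsto.add (NNReal.tendsto_coe.2 hη))).add
      (tendsto_one_div_programBound.mul_const (Fintype.card D * Rmax))).add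
        (tendsto_const_div_log_natCast (Fintype.card D * Rmax))
  simp only [NNReal.coe_zero, add_zero, one_mul, zero_mul] at expanded
  refine expanded.congr' ?_
  filter_upwards [tendsto_log_natCast.eventually_gt_atTop 0] with n hn
  rw [identRegret, add_div, mul_div_cancel_right₀ _ hn.ne']

theorem tendsto_regretBound_div_log (R : O → ℝ) (Rmax : ℝ) {F : Finset (Instance D ν)}
    {f : Instance D ν} (hf : f ∈ F) {η : ℕ → ℝ≥0} (hη : Tendsto η atTop (𝓝 0)) {c A : ℝ}
    (hc : 0 < c) (hA : 0 < A) (q : ℝ) :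
    Tendsto (fun n : ℕ => regretBound R Rmax F f n (η n) c (A * programBound n ^ (-q)) /
      Real.log n) atTop (𝓝 (complexity R F f).toReal) := by
  have steps := (tendsto_initPlays_div_log.const_mul (Fintype.card D * Rmax)).add
    (tendsto_identRegret_div_log R Rmax hf hη)
  have misestimation := (((tendsto_exp_neg_initPlays_mul_identLength_div_log D hc).const_mul
    Rmax).add ((tendsto_exp_neg_initPlays hc).mul (tendsto_ucbBound_div_log R Rmax f))).const_mul
      (F.card : ℝ)
  have falseAcceptance := tendsto_const_div_log_natCast (F.card * Rmax)
  have falseRejection := ((tendsto_exp_neg_rpow_programBound hA q).mul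
    (tendsto_ucbBound_div_log R Rmax f)).const_mul ((F ×ˢ F).card : ℝ)
  have deviation := tendsto_mul_pow_mul_exp_neg_log_div_log (Rmax * (2 * Fintype.card D))
  have total := steps.add (((misestimation.add falseAcceptance).add falseRejection).add deviation)
  simp only [mul_zero, zero_mul, add_zero, zero_add] at total
  refine total.congr' ?_
  filter_upwards [eventually_ge_atTop 1] with n hn
  have n_ne_zero : (n : ℝ) ≠ 0 := by positivity
  rw [regretBound]
  generalize Real.exp (-(c * initPlays n)) = x, Real.exp (-(8 * Real.log n)) = y,
    Real.exp (-(A * programBound n ^ (-q) * Real.log n * _)) = z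
  field_simp

end Limit

section Main

variable {D O : Type*} [MeasurableSpace O] {ν : Measure O} [Fintype D] [DecidableEq D]
  [Nonempty D] [MeasurableSpace D] {R : O → ℝ} {Rmax : ℝ}
  {F : Finset (Instance D ν)} {η : ℕ → ℝ≥0} {fstar : Instance D ν}

theorem eventually_testEnd_le (alg : ∀ n, TestToCommit R Rmax F n (η n)) :
    ∀ᶠ n : ℕ in atTop, ∀ f, (alg n).testEnd f ≤ n := by
  filter_upwards [tendsto_programBound.eventually_ge_atTop 0,
    tendsto_programBound.eventually (eventually_exists_isFeasible R F),
    eventually_card_mul_initPlays_add_identLength_le D] with n hN hfeas hlen f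
  have length_le := (alg n).length_identList_le hN (hfeas f f.2)
  have cast_le : (((alg n).testEnd f : ℕ) : ℝ) ≤ n := by
    rw [TestToCommit.testEnd, (alg n).length_initList]
    push_cast
    linarith
  exact_mod_cast cast_le

variable [DiscreteMeasurableSpace D]

section Record

variable [Nonempty (D × O)]

theorem exists_eventually_regret_le_regretBound (hR : Measurable R) (hRmax : 0 < Rmax)
    (hF : UniformRenyiConvergence F) (alg : ∀ n, TestToCommit R Rmax F n (η n)) (hfstar : fstar ∈ F)
    (hbdd : ∀ π, ∀ᵐ o ∂(fstar.law π), 0 ≤ R o ∧ R o ≤ Rmax) :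
    ∃ c > (0 : ℝ), ∃ A > (0 : ℝ), ∃ q : ℝ, ∀ᶠ n : ℕ in atTop, regret R fstar (alg n).toPolicy n ≤
      regretBound R Rmax F fstar n (η n) c (A * programBound n ^ (-q)) := by
  obtain ⟨c, hc, hsep⟩ := exists_ratioMoment_half_le F
  obtain ⟨A, hA, q, -, hrate⟩ := hF.eventually_ratioMoment_le
    (K := 4 * Fintype.card D) (by exact_mod_cast Nat.mul_pos four_pos Fintype.card_pos)
  refine ⟨c, hc, A, hA, q, ?_⟩
  filter_upwards [eventually_gt_atTop 0, tendsto_programBound.eventually_ge_atTop 1,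
    tendsto_programBound.eventually (eventually_exists_isFeasible R F),
    tendsto_programBound.eventually hrate, eventually_testEnd_le alg] with n hn hN hfeas hrate hend
  exact (alg n).regret_le hn hN hfeas hend hR hRmax hfstar hbdd hc.le (hsep fstar hfstar)
    hrate.1.1 hrate.2

theorem limsup_regret_div_log_le_of_pos (hR : Measurable R) (hRmax : 0 < Rmax)
    (hF : UniformRenyiConvergence F) (hη : Tendsto η atTop (𝓝 0))
    (alg : ∀ n, TestToCommit R Rmax F n (η n)) (hfstar : fstar ∈ F)
    (hbdd : ∀ π, ∀ᵐ o ∂(fstar.law π), 0 ≤ R o ∧ R o ≤ Rmax) :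
    limsup (fun n : ℕ => ((regret R fstar (alg n).toPolicy n / Real.log n : ℝ) : EReal)) atTop
      ≤ complexity R F fstar := by
  obtain ⟨c, hc, A, hA, q, regret_le⟩ :=
    exists_eventually_regret_le_regretBound hR hRmax hF alg hfstar hbdd
  have bound_tendsto := (continuous_coe_real_ereal.tendsto _).comp
    (tendsto_regretBound_div_log R Rmax hfstar hη hc hA q)
  rw [EReal.coe_toReal (complexity_ne_top R hfstar) (complexity_ne_bot R F fstar)] at bound_tendsto
  rw [← bound_tendsto.limsup_eq]
  refine limsup_le_limsup ?_
  filter_upwards [regret_le] with n hn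
  exact EReal.coe_le_coe (div_le_div_of_nonneg_right hn (Real.log_natCast_nonneg n))

end Record

theorem limsup_regret_div_log_le (hR : Measurable R) (hF : UniformRenyiConvergence F)
    (hη : Tendsto η atTop (𝓝 0)) (alg : ∀ n, TestToCommit R Rmax F n (η n)) (hfstar : fstar ∈ F)
    (hbdd : ∀ π, ∀ᵐ o ∂(fstar.law π), 0 ≤ R o ∧ R o ≤ Rmax) :
    limsup (fun n : ℕ => ((regret R fstar (alg n).toPolicy n / Real.log n : ℝ) : EReal)) atTop
      ≤ complexity R F fstar := by
  have := fstar.nonempty_prod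
  rcases lt_or_ge 0 Rmax with Rmax_pos | Rmax_nonpos
  · exact limsup_regret_div_log_le_of_pos hR Rmax_pos hF hη alg hfstar hbdd
  · refine limsup_le_of_le (by isBoundedDefault) (Eventually.of_forall fun n => ?_)
    refine le_trans ?_ (complexity_nonneg R F fstar)
    have regret_nonpos := regret_nonpos_of_gap_nonpos
      (fun π => (gap_le hR hbdd π).trans Rmax_nonpos) (alg n).toPolicy n
    exact_mod_cast div_nonpos_of_nonpos_of_nonneg regret_nonpos (Real.log_natCast_nonneg n)

end Main

end

end DecisionMaking

theorem mainTheorem1_general {D O : Type*} [Fintype D] [DecidableEq D] [Nonempty D]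
    [MeasurableSpace D] [DiscreteMeasurableSpace D] [MeasurableSpace O]
    (ν : Measure O) (R : O → ℝ) (hR : Measurable R) (Rmax : ℝ)
    (F : Finset (DecisionMaking.Instance D ν))
    (hbdd : ∀ f ∈ F, ∀ π, ∀ᵐ o ∂(f.law π), 0 ≤ R o ∧ R o ≤ Rmax)
    (hcond : DecisionMaking.UniformRenyiConvergence F)
    (η : ℕ → ℝ≥0) (hη : Tendsto η atTop (𝓝 0))
    (alg : ∀ n, DecisionMaking.TestToCommit R Rmax F n (η n))
    (fstar : DecisionMaking.Instance D ν) (hfstar : fstar ∈ F) :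
    Tendsto (fun N : ℝ => DecisionMaking.complexityAt R F fstar N) atTop
        (𝓝 (DecisionMaking.complexity R F fstar)) ∧
      DecisionMaking.complexity R F fstar ≠ ⊤ ∧
      limsup (fun n : ℕ =>
          ((DecisionMaking.regret R fstar (alg n).toPolicy n / Real.log n : ℝ) : EReal)) atTop
        ≤ DecisionMaking.complexity R F fstar :=
  ⟨DecisionMaking.tendsto_complexityAt R F fstar, DecisionMaking.complexity_ne_top R hfstar,
    DecisionMaking.limsup_regret_div_log_le hR hcond hη alg hfstar (hbdd fstar hfstar)⟩

theorem mainTheorem1 {D O : Type*} [Fintype D] [DecidableEq D] [Nonempty D]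
    [MeasurableSpace D] [DiscreteMeasurableSpace D] [MeasurableSpace O]
    (ν : Measure O) [SigmaFinite ν]
    (R : O → ℝ) (hR : Measurable R) (Rmax : ℝ)
    (F : Finset (DecisionMaking.Instance D ν))
    (hbdd : ∀ f ∈ F, ∀ π, ∀ᵐ o ∂(f.law π), 0 ≤ R o ∧ R o ≤ Rmax)
    (huniq : ∀ f ∈ F, ∃! π, DecisionMaking.IsOptimal R f π)
    (hcond : DecisionMaking.UniformRenyiConvergence F)
    (η : ℕ → ℝ≥0) (hη : Tendsto η atTop (𝓝 0))
    (alg : ∀ n, DecisionMaking.TestToCommit R Rmax F n (η n))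
    (fstar : DecisionMaking.Instance D ν) (hfstar : fstar ∈ F) :
    Tendsto (fun N : ℝ => DecisionMaking.complexityAt R F fstar N) atTop
        (𝓝 (DecisionMaking.complexity R F fstar)) ∧
      DecisionMaking.complexity R F fstar ≠ ⊤ ∧
      limsup (fun n : ℕ =>
          ((DecisionMaking.regret R fstar (alg n).toPolicy n / Real.log n : ℝ) : EReal)) atTop
        ≤ DecisionMaking.complexity R F fstar :=
  mainTheorem1_general ν R hR Rmax F hbdd hcond η hη alg fstar hfstar
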